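/- All logarithms are to base 2, and sequences are binary. For $x=x_1\cdots x_n\in\{0,1\}^n$ let $\mathrm{VT}^0(x)=\sum_{i=1}^n x_i$ and, for $k\ge 1$, $\mathrm{VT}^k(x)=\sum_{i=1}^n\big(\sum_{j=1}^i j^{k-1}\big)x_i$. Let $\mathcal{B}(x)$ be the set of all sequences obtained from $x$ by exactly one deletion followed by at most one substitution. A code $\mathcal{C}\subseteq\{0,1\}^n$ is an $(n,N;\mathcal{B})$-reconstruction code if $|\mathcal{B}(x)\cap\mathcal{B}(y)|<N$ for all distinct $x,y\in\mathcal{C}$; its redundancy is $\mathrm{red}(\mathcal{C})=n-\log|\mathcal{C}|$. The period of a sequence $w$ is the least $p\ge 1$ with $w_i=w_{i+p}$ whenever $1\le i\le |w|-p$, and $\mathcal{R}(n,2,t)$ is the set of $x\in\{0,1\}^n$ all of whose substrings (of consecutive symbols) with period at most 2 have length at most $t$. For $P\ge1$ and $i\ge 1$ let $x^{(P,i)}=x_{(i-1)P+1}\cdots x_{iP}$ if $i\le\lfloor n/P\rfloor$, let $x^{(P,\lfloor n/P\rfloor+1)}=x_{\lfloor n/P\rfloor P+1}\cdots x_n$ (possibly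 empty), and let $x^{(P,i)}$ be empty for larger $i$. Theorem. Let $n\ge1$, $t=\lceil\log n\rceil+3$ and $P=6t+4$. For integers $s_0\in[0,3]$, $s_1\in[0,2n-1]$ and $g_k,g_k'\in[0,3(2P)^k-1]$ ($k=1,2,3$), let $\mathcal{C}(n,11,\mathcal{B})$ be the set of all $x\in\mathcal{R}(n,2,t)$ such that $$\mathrm{VT}^0(x)\equiv s_0\pmod 4,\qquad \mathrm{VT}^1(x)\equiv s_1\pmod{2n},$$ and, for $k\in\{1,2,3\}$, $$\sum_{i\ge1}\mathrm{VT}^k\big(x^{(P,2i-1)}x^{(P,2i)}\big)\equiv g_k,\qquad \sum_{i\ge1}\mathrm{VT}^k\big(x^{(P,2i)}x^{(P,2i+1)}\big)\equiv g_k'\pmod{3(2P)^k}.$$ Then, for every choice of these parameters, $\mathcal{C}(n,11,\mathcal{B})$ is an $(n,11;\mathcal{B})$-reconstruction code. Moreover, there is an absolute constant $K$ such that for every $n\ge2$ the parameters can be chosen so that $\mathcal{C}(n,11,\mathcal{B})$ is non-empty and $$\mathrm{red}(\mathcal{C}(n,11,\mathcal{B}))\le\log n+12\log\log n+K.$$ 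-/

import Mathlib

namespace Recon

/-- `Σ^n`: the binary sequences of length `n`. -/
def Words (n : ℕ) : Set (List Bool) := {x | x.length = n}

/-- The Hamming distance of two sequences (used for sequences of the same length). -/
def hdist (x y : List Bool) : ℕ := (x.zip y).countP (fun p => p.1 != p.2)

/-- The single-deletion ball: the subsequences of `x` that are shorter by exactly one. -/
def delBall (x : List Bool) : Set (List Bool) :=
  {y | y.length + 1 = x.length ∧ y.Sublist x}

/-- The single-substitution ball: same length and Hamming distance at most one. -/
def subBall (x : List Bool) : Set (List Bool) :=
  {y | y.length = x.length ∧ hdist x y ≤ 1}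

/-- The single-deletion single-substitution ball: one deletion followed by one substitution
(a substitution may leave the sequence unchanged). -/
def dsBall (x : List Bool) : Set (List Bool) :=
  {z | ∃ y ∈ delBall x, z ∈ subBall y}

/-- `C` is an `(n, N; B)`-reconstruction code. -/
def IsReconstructionCode (n N : ℕ) (C : Set (List Bool)) : Prop :=
  C ⊆ Words n ∧ ∀ x ∈ C, ∀ y ∈ C, x ≠ y → (dsBall x ∩ dsBall y).encard < (N : ℕ∞)

/-- The redundancy `n - log₂ |C|` of a code `C ⊆ Σ^n`. -/
noncomputable def redundancy (n : ℕ) (C : Set (List Bool)) : ℝ :=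
  (n : ℝ) - Real.logb 2 (C.ncard : ℝ)

/-- The `k`-th order VT syndrome: the weight for `k = 0`, and
`∑_{i=1}^n ∑_{j=1}^i j^(k-1) x_i` for `k ≥ 1`. The index `i : Fin x.length` stands for the
position `i + 1`. -/
def vt : ℕ → List Bool → ℕ
  | 0, x => ∑ i : Fin x.length, (x.get i).toNat
  | k + 1, x => ∑ i : Fin x.length, ∑ j ∈ Finset.Icc 1 ((i : ℕ) + 1), j ^ k * (x.get i).toNat

/-- `x_i = x_{i+p}` whenever both positions exist. -/
def ShiftInvariant (p : ℕ) (x : List Bool) : Prop :=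
  ∀ i, i + p < x.length → x[i]? = x[i + p]?

/-- `p` is the period of `x`: the smallest positive shift that leaves `x` invariant. -/
def HasPeriod (p : ℕ) (x : List Bool) : Prop :=
  IsLeast {q | 0 < q ∧ ShiftInvariant q x} p

/-- `R(n, t', t)`: the sequences of length `n` in which every substring of period at most `t'`
has length at most `t`. -/
def periodBounded (n t' t : ℕ) : Set (List Bool) :=
  {x | x ∈ Words n ∧ ∀ w : List Bool, w <:+: x → (∃ p ≤ t', HasPeriod p w) → w.length ≤ t}

/-- The code `C₁`. -/
def codeVT (n s₀ s₁ : ℕ) : Set (List Bool) :=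
  {x | x ∈ Words n ∧ vt 0 x ≡ s₀ [MOD 4] ∧ vt 1 x ≡ s₁ [MOD 2 * n]}

/-- The `i`-th block (`i ≥ 1`) of `x` cut into blocks of length `P`: the positions
`(i-1)P+1, …, iP` as far as they exist. The block number `⌊n/P⌋ + 1` is the (possibly empty)
remainder, and later blocks are empty. -/
def block (P : ℕ) (x : List Bool) (i : ℕ) : List Bool :=
  (x.drop ((i - 1) * P)).take P

/-- `∑_i VT^k(x^{(P,2i-1)} x^{(P,2i)})`; for `k ≥ 1` the pairs of empty blocks contribute `0`. -/
def oddBlockSum (P k : ℕ) (x : List Bool) : ℕ :=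
  ∑ i ∈ Finset.Icc 1 (x.length / P + 1), vt k (block P x (2 * i - 1) ++ block P x (2 * i))

/-- `∑_i VT^k(x^{(P,2i)} x^{(P,2i+1)})`. -/
def evenBlockSum (P k : ℕ) (x : List Bool) : ℕ :=
  ∑ i ∈ Finset.Icc 1 (x.length / P + 1), vt k (block P x (2 * i) ++ block P x (2 * i + 1))

/-- The code given by the VT constraints of orders 1, 2, 3 on pairs of consecutive blocks of
length `P`. The residues of order `k + 1` are `g k` and `g' k`. -/
def codeBlocks (n P : ℕ) (g g' : Fin 3 → ℕ) : Set (List Bool) :=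
  {x | x ∈ Words n ∧ ∀ k : Fin 3,
    oddBlockSum P ((k : ℕ) + 1) x ≡ g k [MOD 3 * (2 * P) ^ ((k : ℕ) + 1)] ∧
    evenBlockSum P ((k : ℕ) + 1) x ≡ g' k [MOD 3 * (2 * P) ^ ((k : ℕ) + 1)]}

/-- `t = ⌈log₂ n⌉ + 3`. -/
noncomputable def tParam (n : ℕ) : ℕ := ⌈Real.logb 2 (n : ℝ)⌉₊ + 3

/-- `P = 6 t + 4`. -/
noncomputable def pParam (n : ℕ) : ℕ := 6 * tParam n + 4

/-- The code `C(n, 11, B)` with parameters `s₀, s₁, g, g'`. -/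
noncomputable def code11 (n s₀ s₁ : ℕ) (g g' : Fin 3 → ℕ) : Set (List Bool) :=
  periodBounded n 2 (tParam n) ∩ codeVT n s₀ s₁ ∩ codeBlocks n (pParam n) g g'

/-- The ranges of the parameters. -/
def ValidParams (n s₀ s₁ : ℕ) (g g' : Fin 3 → ℕ) : Prop :=
  s₀ < 4 ∧ s₁ < 2 * n ∧
    ∀ k : Fin 3, g k < 3 * (2 * pParam n) ^ ((k : ℕ) + 1) ∧
      g' k < 3 * (2 * pParam n) ^ ((k : ℕ) + 1)

end Recon

/-!
Let `x ≠ y` be codewords with a common descendant. The suffix difference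
`S m = ∑ k ≥ m, (x k - y k)` is the sum of two step functions of height at most `1`, one for each
substitution, and a term with values in `{0, 1}` or in `{-1, 0}` coming from the deletions; so
`|S| ≤ 3`. The weight modulo `4` therefore forces `S 0 = 0`, after which `|S| ≤ 2` and `S` changes
sign at most twice. The syndromes `VT^1`, `VT^2`, `VT^3` are moments of `S`, and the bound
on `S` turns their congruences into equalities. If all differences of `x` and `y` fitted into one
window of two blocks, the moments of orders `0`, `1`, `2` on it would vanish; a quadratic weight
with the signs of `S` then gives `S = 0`. Hence the first and the last difference are more than
`6 t` apart, and as the weights and `VT^1` agree, there are at least four differences.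

Now split the common descendants by the order of the two deletion points. If one order does not
occur, there are at most `5 + 5` descendants: up to two substitutions, one of the deletions happens
at an extreme difference, and the substituted position is determined up to a few choices. If both
orders occur, then away from boundedly many positions `x` agrees with the shift of `y` and `y` with
the shift of `x`, which would give a substring of period `2` and length greater than `t`; the
exceptions left by this allow at most `4` descendants for each order.

For the redundancy, a union bound over the windows of length `t + 1` and period at most `2` keeps at
least half of all words, and these are distributed over `5832 * n * (2 * P) ^ 12` residue tuples.
-/

namespace Recon

section Hamming

variable {ι κ α : Type*} {j k : ℕ} {u v w : ι → α}

/-- `HammingLE k u v` says that the words `u` and `v` differ in at most `k` positions; the index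
set may be infinite. -/
def HammingLE (k : ℕ) (u v : ι → α) : Prop := {m | u m ≠ v m}.encard ≤ k

theorem HammingLE.symm (h : HammingLE k u v) : HammingLE k v u := by
  simpa only [HammingLE, ne_comm] using h

theorem HammingLE.trans (h : HammingLE j u v) (h' : HammingLE k v w) : HammingLE (j + k) u w := by
  have hsub : {m | u m ≠ w m} ⊆ {m | u m ≠ v m} ∪ {m | v m ≠ w m} :=
    fun m hm => (Ne.ne_or_ne (v m) hm).imp id Ne.symm
  calc {m | u m ≠ w m}.encard ≤ {m | u m ≠ v m}.encard + {m | v m ≠ w m}.encard :=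
        (Set.encard_le_encard hsub).trans (Set.encard_union_le _ _)
    _ ≤ j + k := add_le_add h h'
    _ = ((j + k : ℕ) : ℕ∞) := by push_cast; rfl

theorem HammingLE.comp_injective (h : HammingLE k u v) {e : κ → ι} (he : e.Injective) :
    HammingLE k (u ∘ e) (v ∘ e) := by
  rw [HammingLE, ← he.encard_image]
  exact (Set.encard_le_encard (Set.image_subset_iff.2 fun _ hm => hm)).trans h

theorem HammingLE.exists_finset (h : HammingLE k u v) :
    ∃ D : Finset ι, D.card ≤ k ∧ ∀ m, u m ≠ v m → m ∈ D := by
  have hfin : {m | u m ≠ v m}.Finite := Set.finite_of_encard_le_coe h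
  refine ⟨hfin.toFinset, ?_, fun m hm => hfin.mem_toFinset.2 hm⟩
  rwa [HammingLE, hfin.encard_eq_coe_toFinset_card, Nat.cast_le] at h

theorem HammingLE.eq_of_ne (h : HammingLE 1 u v) {a b : ι} (ha : u a ≠ v a) (hb : u b ≠ v b) :
    a = b :=
  Set.encard_le_one_iff.1 h a b ha hb

theorem HammingLE.not_three (h : HammingLE 2 u v) {a b c : ι} (ha : u a ≠ v a) (hb : u b ≠ v b)
    (hc : u c ≠ v c) (hab : a ≠ b) (hac : a ≠ c) (hbc : b ≠ c) : False := by
  have hsub : ({a, b, c} : Set ι) ⊆ {m | u m ≠ v m} := by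
    rintro m (rfl | rfl | rfl) <;> assumption
  have hcard : ({a, b, c} : Set ι).encard = 3 := Set.encard_eq_three.2 ⟨a, b, c, hab, hac, hbc, rfl⟩
  exact absurd (hcard ▸ (Set.encard_le_encard hsub).trans h) (by decide)

variable [DecidableEq ι] {z p q : ι → Bool}

theorem HammingLE.eq_or_eq_update (hp : HammingLE 1 z p) (hq : HammingLE 1 z q) (hpq : p ≠ q) :
    z = q ∨ ∃ a, p a ≠ q a ∧ z = Function.update q a (!q a) := by
  rw [or_iff_not_imp_left]
  intro hz
  obtain ⟨a, ha⟩ := Function.ne_iff.1 hz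
  refine ⟨a, fun hpa => hpq (funext fun m => ?_), funext fun m => ?_⟩
  · by_cases hm : m = a
    · rw [hm, hpa]
    · rw [← not_ne_iff.1 fun h => hm (hp.eq_of_ne h (hpa ▸ ha)),
        not_ne_iff.1 fun h => hm (hq.eq_of_ne h ha)]
  · rcases eq_or_ne m a with rfl | hm
    · rw [Function.update_self, Bool.eq_not.2 ha]
    · rw [Function.update_of_ne hm, not_ne_iff.1 fun h => hm (hq.eq_of_ne h ha)]

theorem HammingLE.eq_update_of_ne_of_ne (hp : HammingLE 1 z p) (hq : HammingLE 1 z q) {a b : ι}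
    (hab : a ≠ b) (ha : p a ≠ q a) (hb : p b ≠ q b) :
    z = Function.update q a (!q a) ∨ z = Function.update q b (!q b) := by
  rcases hp.eq_or_eq_update hq (Function.ne_iff.2 ⟨a, ha⟩) with rfl | ⟨c, hc, hz⟩
  · exact absurd (hp.eq_of_ne ha.symm hb.symm) hab
  · by_cases hca : c = a
    · exact Or.inl (hca ▸ hz)
    · by_cases hcb : c = b
      · exact Or.inr (hcb ▸ hz)
      · exact ((hp.symm.trans hq).not_three hc ha hb hca hcb hab).elim

end Hamming

section Deletion

variable {α : Type*} {i j m : ℤ}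

/-- The two-sided infinite word `x` after the deletion of the letter at position `i`; the letters
to the right of `i` move one place to the left. -/
def deleteAt (i : ℤ) (x : ℤ → α) : ℤ → α := fun m => if m < i then x m else x (m + 1)

/-- The mirror image of a two-sided infinite word. -/
def mirror (x : ℤ → α) : ℤ → α := fun m => x (-m)

/-- The mirror image of a two-sided infinite word about `-1/2` instead of `0`, which is the
reflection that turns a deletion in `x` into a deletion in `mirror x`. -/
def mirrorHalf (z : ℤ → α) : ℤ → α := fun m => z (-m - 1)

theorem deleteAt_of_lt (x : ℤ → α) (h : m < i) : deleteAt i x m = x m := if_pos h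

theorem deleteAt_of_le (x : ℤ → α) (h : i ≤ m) : deleteAt i x m = x (m + 1) := if_neg h.not_gt

theorem deleteAt_eq_deleteAt {x : ℤ → α} (hij : i ≤ j)
    (h : ∀ m, i ≤ m → m < j → x m = x (m + 1)) : deleteAt i x = deleteAt j x := by
  funext m
  rcases lt_or_ge m i with hi | hi
  · rw [deleteAt_of_lt x hi, deleteAt_of_lt x (hi.trans_le hij)]
  rcases lt_or_ge m j with hj | hj
  · rw [deleteAt_of_le x hi, deleteAt_of_lt x hj, h m hi hj]
  · rw [deleteAt_of_le x hi, deleteAt_of_le x hj]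

theorem mirrorHalf_mirrorHalf (z : ℤ → α) : mirrorHalf (mirrorHalf z) = z := by
  funext m
  simp only [mirrorHalf]
  congr 1
  ring

theorem mirrorHalf_deleteAt (i : ℤ) (x : ℤ → α) :
    mirrorHalf (deleteAt i x) = deleteAt (-i) (mirror x) := by
  funext m
  rcases lt_or_ge m (-i) with h | h
  · rw [deleteAt_of_lt _ h, mirrorHalf, deleteAt_of_le x (by omega), mirror]
    congr 1
    ring
  · rw [deleteAt_of_le _ h, mirrorHalf, deleteAt_of_lt x (by omega), mirror]
    congr 1
    ring

theorem HammingLE.mirrorHalf {k : ℕ} {u v : ℤ → α} (h : HammingLE k u v) :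
    HammingLE k (mirrorHalf u) (mirrorHalf v) :=
  h.comp_injective fun a b (hab : -a - 1 = -b - 1) => by omega

theorem HammingLE.mirror_deleteAt {k : ℕ} {x y : ℤ → α}
    (h : HammingLE k (deleteAt i x) (deleteAt j y)) :
    HammingLE k (deleteAt (-i) (mirror x)) (deleteAt (-j) (mirror y)) := by
  simpa only [mirrorHalf_deleteAt] using h.mirrorHalf

variable {x y : ℤ → α}

theorem deleteAt_ne_deleteAt_of_lt (hij : i ≤ j) (hm : m < i) :
    deleteAt i x m ≠ deleteAt j y m ↔ x m ≠ y m := by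
  rw [deleteAt_of_lt x hm, deleteAt_of_lt y (hm.trans_le hij)]

theorem deleteAt_ne_deleteAt_of_le_of_lt (hi : i ≤ m) (hj : m < j) :
    deleteAt i x m ≠ deleteAt j y m ↔ x (m + 1) ≠ y m := by
  rw [deleteAt_of_le x hi, deleteAt_of_lt y hj]

theorem deleteAt_ne_deleteAt_of_gt (hij : i ≤ j) (hm : j < m) :
    deleteAt i x (m - 1) ≠ deleteAt j y (m - 1) ↔ x m ≠ y m := by
  rw [deleteAt_of_le x (by omega), deleteAt_of_le y (by omega), sub_add_cancel]

end Deletion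

/-- The letter of `x` at position `m` as an integer, for the moment computations. -/
def bit (x : ℤ → Bool) (m : ℤ) : ℤ := (x m).toNat

theorem bit_nonneg (x : ℤ → Bool) (m : ℤ) : 0 ≤ bit x m := Int.natCast_nonneg _

theorem bit_le_one (x : ℤ → Bool) (m : ℤ) : bit x m ≤ 1 :=
  Int.ofNat_le.2 (Bool.toNat_le (x m))

theorem bit_eq_zero_or_one (x : ℤ → Bool) (m : ℤ) : bit x m = 0 ∨ bit x m = 1 := by
  have := bit_nonneg x m
  have := bit_le_one x m
  omega

theorem bit_eq_bit_iff {x y : ℤ → Bool} {m k : ℤ} : bit x m = bit y k ↔ x m = y k := by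
  simp only [bit, Nat.cast_inj]
  cases x m <;> cases y k <;> decide

theorem bit_sub_eq_zero {x y : ℤ → Bool} {m k : ℤ} (h : x m = y k) : bit x m - bit y k = 0 :=
  sub_eq_zero.2 (bit_eq_bit_iff.2 h)

theorem bit_sub_of_ne {x y : ℤ → Bool} {m k : ℤ} (h : x m ≠ y k) :
    bit x m - bit y k = 1 ∨ bit x m - bit y k = -1 := by
  have := mt bit_eq_bit_iff.1 h
  have := bit_eq_zero_or_one x m
  have := bit_eq_zero_or_one y k
  omega

theorem sum_bit_nonneg (x : ℤ → Bool) (i j : ℤ) : 0 ≤ ∑ m ∈ Finset.Ico i j, bit x (m + 1) :=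
  Finset.sum_nonneg fun m _ => bit_nonneg x (m + 1)

theorem sum_bit_le (x : ℤ → Bool) {i j : ℤ} (hij : i ≤ j) :
    ∑ m ∈ Finset.Ico i j, bit x (m + 1) ≤ j - i := by
  calc ∑ m ∈ Finset.Ico i j, bit x (m + 1) ≤ ∑ _ ∈ Finset.Ico i j, (1 : ℤ) :=
        Finset.sum_le_sum fun m _ => bit_le_one x (m + 1)
    _ = j - i := by simp [hij]

theorem sum_Ico_split (g : ℤ → ℤ) {a b c : ℤ} (hab : a ≤ b) (hbc : b ≤ c) :
    ∑ m ∈ Finset.Ico a c, g m = ∑ m ∈ Finset.Ico a b, g m + ∑ m ∈ Finset.Ico b c, g m := by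
  rw [← Finset.Ico_union_Ico_eq_Ico hab hbc,
    Finset.sum_union (Finset.Ico_disjoint_Ico_consecutive a b c)]

theorem sum_Ico_eq_add_sum_Ico (g : ℤ → ℤ) {a b : ℤ} (hab : a < b) :
    ∑ m ∈ Finset.Ico a b, g m = g a + ∑ m ∈ Finset.Ico (a + 1) b, g m := by
  rw [← Finset.insert_Ico_add_one_left_eq_Ico hab, Finset.sum_insert (by simp)]

theorem sum_Icc_sub_eq_shift (g h : ℤ → ℤ) {f i j l : ℤ} (hfi : f ≤ i) (hij : i ≤ j)
    (hjl : j ≤ l) :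
    ∑ m ∈ Finset.Icc f l, (g m - h m) =
      ∑ m ∈ Finset.Ico f i, (g m - h m) + (g i - h j) +
        ∑ m ∈ Finset.Ico i j, (g (m + 1) - h m) +
        ∑ m ∈ Finset.Ico (j + 1) (l + 1), (g m - h m) := by
  have hIcc : Finset.Icc f l = Finset.Ico f (l + 1) := by ext; simp
  have hg : ∑ m ∈ Finset.Ico f (l + 1), g m = ∑ m ∈ Finset.Ico f i, g m +
      (g i + (∑ m ∈ Finset.Ico i j, g (m + 1) + ∑ m ∈ Finset.Ico (j + 1) (l + 1), g m)) := by
    rw [sum_Ico_split g hfi (by omega), sum_Ico_eq_add_sum_Ico g (by omega : i < l + 1),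
      sum_Ico_split g (by omega : i + 1 ≤ j + 1) (by omega), ← Finset.sum_Ico_add' g i j 1]
  have hh : ∑ m ∈ Finset.Ico f (l + 1), h m = ∑ m ∈ Finset.Ico f i, h m +
      (∑ m ∈ Finset.Ico i j, h m + (h j + ∑ m ∈ Finset.Ico (j + 1) (l + 1), h m)) := by
    rw [sum_Ico_split h hfi (by omega), sum_Ico_split h hij (by omega),
      sum_Ico_eq_add_sum_Ico h (by omega : j < l + 1)]
  simp only [hIcc, Finset.sum_sub_distrib, hg, hh]
  ring

/-- `f < f₂` are the first two and `l₂ < l` the last two positions in which `x` and `y` differ,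
and the differences have vanishing moments of orders `0` and `1`. -/
structure BalancedPair (x y : ℤ → Bool) (f f₂ l₂ l : ℤ) : Prop where
  lt_first : f < f₂
  lt_mid : f₂ < l₂
  lt_last : l₂ < l
  ne_f : x f ≠ y f
  ne_f₂ : x f₂ ≠ y f₂
  ne_l₂ : x l₂ ≠ y l₂
  ne_l : x l ≠ y l
  before : ∀ m, m < f → x m = y m
  gap_first : ∀ m, f < m → m < f₂ → x m = y m
  gap_last : ∀ m, l₂ < m → m < l → x m = y m
  after : ∀ m, l < m → x m = y m
  sum_zero : ∑ m ∈ Finset.Icc f l, (bit x m - bit y m) = 0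
  sum_one : ∑ m ∈ Finset.Icc f l, (m * bit x m - m * bit y m) = 0

theorem sum_Icc_neg (g : ℤ → ℤ) (a b : ℤ) :
    ∑ m ∈ Finset.Icc (-b) (-a), g m = ∑ m ∈ Finset.Icc a b, g (-m) :=
  Finset.sum_equiv (Equiv.neg ℤ) (fun m => by simp [and_comm, neg_le, le_neg]) (by simp)

namespace BalancedPair

variable {x y : ℤ → Bool} {f f₂ l₂ l : ℤ}

theorem symm (C : BalancedPair x y f f₂ l₂ l) : BalancedPair y x f f₂ l₂ l where
  lt_first := C.lt_first
  lt_mid := C.lt_mid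
  lt_last := C.lt_last
  ne_f := C.ne_f.symm
  ne_f₂ := C.ne_f₂.symm
  ne_l₂ := C.ne_l₂.symm
  ne_l := C.ne_l.symm
  before m h := (C.before m h).symm
  gap_first m h h' := (C.gap_first m h h').symm
  gap_last m h h' := (C.gap_last m h h').symm
  after m h := (C.after m h).symm
  sum_zero := by
    simpa only [← Finset.sum_neg_distrib, neg_sub, neg_zero] using congrArg Neg.neg C.sum_zero
  sum_one := by
    simpa only [← Finset.sum_neg_distrib, neg_sub, neg_zero] using congrArg Neg.neg C.sum_one

theorem mirror (C : BalancedPair x y f f₂ l₂ l) :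
    BalancedPair (mirror y) (mirror x) (-l) (-l₂) (-f₂) (-f) where
  lt_first := neg_lt_neg C.lt_last
  lt_mid := neg_lt_neg C.lt_mid
  lt_last := neg_lt_neg C.lt_first
  ne_f := by simpa [Recon.mirror] using C.ne_l.symm
  ne_f₂ := by simpa [Recon.mirror] using C.ne_l₂.symm
  ne_l₂ := by simpa [Recon.mirror] using C.ne_f₂.symm
  ne_l := by simpa [Recon.mirror] using C.ne_f.symm
  before m h := (C.after (-m) (by omega)).symm
  gap_first m h h' := (C.gap_last (-m) (by omega) (by omega)).symm
  gap_last m h h' := (C.gap_first (-m) (by omega) (by omega)).symm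
  after m h := (C.before (-m) (by omega)).symm
  sum_zero := by
    rw [sum_Icc_neg]
    simpa [Recon.mirror, bit] using C.symm.sum_zero
  sum_one := by
    rw [sum_Icc_neg, ← C.sum_one]
    refine Finset.sum_congr rfl fun m _ => ?_
    simp only [Recon.mirror, bit, neg_neg]
    ring

theorem moments_shift (C : BalancedPair x y f f₂ l₂ l) {j : ℤ} (hj : f₂ ≤ j) (hjl : j ≤ l) :
    bit x f - bit y f + (bit x f₂ - bit y j) +
        ∑ m ∈ Finset.Ico f₂ j, (bit x (m + 1) - bit y m) +
        ∑ m ∈ Finset.Ico (j + 1) (l + 1), (bit x m - bit y m) = 0 ∧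
      f * (bit x f - bit y f) + (f₂ * bit x f₂ - j * bit y j) +
        (∑ m ∈ Finset.Ico f₂ j, m * (bit x (m + 1) - bit y m) +
          ∑ m ∈ Finset.Ico f₂ j, bit x (m + 1)) +
        ∑ m ∈ Finset.Ico (j + 1) (l + 1), m * (bit x m - bit y m) = 0 := by
  have hgap : ∀ m ∈ Finset.Ico f f₂, m ≠ f → bit x m - bit y m = 0 := fun m hm hmf => by
    rw [Finset.mem_Ico] at hm
    exact bit_sub_eq_zero (C.gap_first m (by omega) hm.2)
  have hf : f ∈ Finset.Ico f f₂ := Finset.left_mem_Ico.2 C.lt_first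
  constructor
  · rw [← C.sum_zero, sum_Icc_sub_eq_shift (bit x) (bit y) C.lt_first.le hj hjl,
      Finset.sum_eq_single_of_mem f hf hgap]
  · rw [← C.sum_one, sum_Icc_sub_eq_shift (fun m => m * bit x m) (fun m => m * bit y m)
      C.lt_first.le hj hjl, ← Finset.sum_add_distrib]
    simp only [← mul_sub]
    rw [Finset.sum_eq_single_of_mem f hf fun m hm hmf => by rw [hgap m hm hmf, mul_zero]]
    congr 2
    exact Finset.sum_congr rfl fun m _ => by ring

theorem exists_mismatch_inner (C : BalancedPair x y f f₂ l₂ l) :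
    ∃ q, f₂ ≤ q ∧ q < l₂ ∧ x (q + 1) ≠ y q := by
  by_contra! h
  have hf := C.lt_first
  have hm := C.lt_mid
  have hl := C.lt_last
  obtain ⟨h0, h1⟩ := C.moments_shift hm.le hl.le
  have hz : ∀ m ∈ Finset.Ico f₂ l₂, bit x (m + 1) - bit y m = 0 := fun m hm => by
    rw [Finset.mem_Ico] at hm
    exact bit_sub_eq_zero (h m hm.1 hm.2)
  have hgap : ∀ m ∈ Finset.Ico (l₂ + 1) (l + 1), m ≠ l → bit x m - bit y m = 0 :=
    fun m hm hml => by
      rw [Finset.mem_Ico] at hm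
      exact bit_sub_eq_zero (C.gap_last m (by omega) (by omega))
  have hmem : l ∈ Finset.Ico (l₂ + 1) (l + 1) := Finset.mem_Ico.2 (by omega)
  rw [Finset.sum_eq_zero hz, Finset.sum_eq_single_of_mem l hmem hgap] at h0
  rw [Finset.sum_eq_zero fun m hm => by rw [hz m hm, mul_zero],
    Finset.sum_eq_single_of_mem l hmem fun m hm hml => by rw [hgap m hm hml, mul_zero]] at h1
  have hsum_nonneg := sum_bit_nonneg x f₂ l₂
  have hsum_le := sum_bit_le x hm.le
  rcases bit_eq_zero_or_one x f₂ with hx | hx <;> rcases bit_eq_zero_or_one y l₂ with hy | hy <;>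
    rcases bit_sub_of_ne C.ne_f with hdf | hdf <;> rcases bit_sub_of_ne C.ne_l with hdl | hdl <;>
    rw [hdf, hx, hy, hdl] at h0 h1 <;> linarith

theorem exists_mismatch (C : BalancedPair x y f f₂ l₂ l) :
    ∃ q, f₂ ≤ q ∧ q < l ∧ x (q + 1) ≠ y q :=
  let ⟨q, hq, hql, hne⟩ := C.exists_mismatch_inner
  ⟨q, hq, hql.trans C.lt_last, hne⟩

theorem mismatch_sub_le (C : BalancedPair x y f f₂ l₂ l) {q : ℤ} (hfq : f₂ ≤ q) (hql : q < l)
    (hq : x (q + 1) ≠ y q) (huniq : ∀ m, f₂ ≤ m → m < l → m ≠ q → x (m + 1) = y m) :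
    q - f ≤ l - f₂ := by
  have hfl : f₂ ≤ l := hfq.trans hql.le
  obtain ⟨h0, h1⟩ := C.moments_shift hfl le_rfl
  have hz : ∀ m ∈ Finset.Ico f₂ l, m ≠ q → bit x (m + 1) - bit y m = 0 := fun m hm hmq => by
    rw [Finset.mem_Ico] at hm
    exact bit_sub_eq_zero (huniq m hm.1 hm.2 hmq)
  have hmem : q ∈ Finset.Ico f₂ l := Finset.mem_Ico.2 ⟨hfq, hql⟩
  rw [Finset.sum_eq_single_of_mem q hmem hz, Finset.Ico_self, Finset.sum_empty] at h0
  rw [Finset.sum_eq_single_of_mem q hmem fun m hm hmq => by rw [hz m hm hmq, mul_zero],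
    Finset.Ico_self, Finset.sum_empty] at h1
  have hsum_nonneg := sum_bit_nonneg x f₂ l
  have hsum_le := sum_bit_le x hfl
  rcases bit_eq_zero_or_one x f₂ with hx | hx <;> rcases bit_eq_zero_or_one y l with hy | hy <;>
    rcases bit_sub_of_ne C.ne_f with hdf | hdf <;> rcases bit_sub_of_ne hq with hdq | hdq <;>
    rw [hdf, hx, hy, hdq] at h0 h1 <;> linarith

end BalancedPair

/-- The words `z` obtained from `x` and from `y` by a deletion and at most one substitution, where
the deletion in `x` is not to the right of the deletion in `y`. -/
def forwardSet (x y : ℤ → Bool) : Set (ℤ → Bool) :=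
  {z | ∃ i j, i ≤ j ∧ HammingLE 1 z (deleteAt i x) ∧ HammingLE 1 z (deleteAt j y)}

/-- The part of `forwardSet x y` in which the letter of `y` at position `l` is deleted. -/
def anchoredSet (x y : ℤ → Bool) (l : ℤ) : Set (ℤ → Bool) :=
  {z | ∃ i ≤ l, HammingLE 1 z (deleteAt i x) ∧ HammingLE 1 z (deleteAt l y)}

namespace BalancedPair

variable {x y z : ℤ → Bool} {f f₂ l₂ l i j p q : ℤ}

theorem deleteAt_ne_deleteAt_last (C : BalancedPair x y f f₂ l₂ l) (hil : i ≤ l) :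
    deleteAt i x ≠ deleteAt l y := by
  have := C.lt_first
  rcases lt_or_ge f i with hi | hi
  · exact Function.ne_iff.2 ⟨f, (deleteAt_ne_deleteAt_of_lt hil hi).2 C.ne_f⟩
  · obtain ⟨q, hfq, hql, hq⟩ := C.exists_mismatch
    exact Function.ne_iff.2 ⟨q, (deleteAt_ne_deleteAt_of_le_of_lt (by omega) hql).2 hq⟩

theorem mismatch_of_first_lt (C : BalancedPair x y f f₂ l₂ l) (hfq : f₂ ≤ q) (hql : q < l)
    (hq : x (q + 1) ≠ y q) (hi : f < i) (hil : i ≤ l)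
    (h : HammingLE 2 (deleteAt i x) (deleteAt l y)) (hp : deleteAt i x p ≠ deleteAt l y p) :
    p = f ∨ p = f₂ ∨ p = q := by
  have := C.lt_first
  have hf := (deleteAt_ne_deleteAt_of_lt hil hi).2 C.ne_f
  by_contra! hne
  rcases le_or_gt i f₂ with hi₂ | hi₂
  · exact h.not_three hp hf ((deleteAt_ne_deleteAt_of_le_of_lt (by omega) hql).2 hq)
      hne.1 hne.2.2 (by omega)
  · exact h.not_three hp hf ((deleteAt_ne_deleteAt_of_lt hil hi₂).2 C.ne_f₂)
      hne.1 hne.2.1 (by omega)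

theorem mismatch_bounds (C : BalancedPair x y f f₂ l₂ l) (hi : i ≤ f)
    (hp : deleteAt i x p ≠ deleteAt l y p) : i ≤ p ∧ p < l ∧ x (p + 1) ≠ y p := by
  have := C.lt_first
  have := C.lt_mid
  have := C.lt_last
  rcases lt_or_ge p i with h | h
  · exact absurd (C.before p (by omega)) ((deleteAt_ne_deleteAt_of_lt (by omega) h).1 hp)
  rcases lt_or_ge p l with h' | h'
  · exact ⟨h, h', (deleteAt_ne_deleteAt_of_le_of_lt h h').1 hp⟩
  · rw [deleteAt_of_le x h, deleteAt_of_le y h'] at hp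
    exact absurd (C.after _ (by omega)) hp

-- A deletion further to the left only adds mismatches on its left, so the second mismatch is the
-- rightmost possible one.
theorem exists_mismatch_of_le_first (C : BalancedPair x y f f₂ l₂ l) (hfq : f₂ ≤ q) (hql : q < l)
    (hq : x (q + 1) ≠ y q) :
    ∃ e, ∀ i ≤ f, HammingLE 2 (deleteAt i x) (deleteAt l y) →
      ∀ p, deleteAt i x p ≠ deleteAt l y p → p = q ∨ p = e := by
  have := C.lt_first
  by_cases hS : ∃ m, m < l ∧ x (m + 1) ≠ y m ∧ m ≠ q
  · obtain ⟨e, ⟨hel, he, heq⟩, hmax⟩ := Int.exists_greatest_of_bdd ⟨l, fun m hm => hm.1.le⟩ hS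
    refine ⟨e, fun i hi h p hp => ?_⟩
    by_contra! hne
    obtain ⟨hip, hpl, hxy⟩ := C.mismatch_bounds hi hp
    have hpe : p ≤ e := hmax p ⟨hpl, hxy, hne.1⟩
    exact h.not_three hp ((deleteAt_ne_deleteAt_of_le_of_lt (by omega) hql).2 hq)
      ((deleteAt_ne_deleteAt_of_le_of_lt (by omega) hel).2 he) hne.1 hne.2 heq.symm
  · push Not at hS
    refine ⟨q, fun i hi _ p hp => ?_⟩
    obtain ⟨-, hpl, hxy⟩ := C.mismatch_bounds hi hp
    exact Or.inl (hS p hpl hxy)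

theorem encard_anchoredSet_le (C : BalancedPair x y f f₂ l₂ l) :
    (anchoredSet x y l).encard ≤ 5 := by
  classical
  obtain ⟨q, hfq, hql, hq⟩ := C.exists_mismatch
  obtain ⟨e, he⟩ := C.exists_mismatch_of_le_first hfq hql hq
  let v := deleteAt l y
  let w (p : ℤ) := Function.update v p (!v p)
  have hsub : anchoredSet x y l ⊆ (({v, w f, w f₂, w q, w e} : Finset (ℤ → Bool)) : Set _) := by
    rintro z ⟨i, hil, hu, hv⟩
    simp only [Finset.coe_insert, Finset.coe_singleton, Set.mem_insert_iff, Set.mem_singleton_iff]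
    rcases hu.eq_or_eq_update hv (C.deleteAt_ne_deleteAt_last hil) with rfl | ⟨p, hp, rfl⟩
    · exact Or.inl rfl
    have h := hu.symm.trans hv
    rcases le_or_gt i f with hi | hi
    · rcases he i hi h p hp with rfl | rfl <;> simp [w, v]
    · rcases C.mismatch_of_first_lt hfq hql hq hi hil h hp with rfl | rfl | rfl <;> simp [w, v]
  refine (Set.encard_le_encard hsub).trans ?_
  rw [Set.encard_coe_eq_coe_finsetCard]
  exact_mod_cast Finset.card_le_five

theorem le_or_le_of_forward (C : BalancedPair x y f f₂ l₂ l) (hij : i ≤ j)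
    (h : HammingLE 2 (deleteAt i x) (deleteAt j y)) : i ≤ f ∨ l ≤ j := by
  by_contra! hfl
  have := C.lt_first
  have := C.lt_mid
  have := C.lt_last
  have hf := (deleteAt_ne_deleteAt_of_lt hij hfl.1).2 C.ne_f
  have hl := (deleteAt_ne_deleteAt_of_gt hij hfl.2).2 C.ne_l
  rcases lt_or_ge f₂ i with hi | hi
  · exact h.not_three hf ((deleteAt_ne_deleteAt_of_lt hij hi).2 C.ne_f₂) hl
      (by omega) (by omega) (by omega)
  rcases lt_or_ge j l₂ with hj | hj
  · exact h.not_three hf ((deleteAt_ne_deleteAt_of_gt hij hj).2 C.ne_l₂) hl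
      (by omega) (by omega) (by omega)
  obtain ⟨q, hfq, hql, hq⟩ := C.exists_mismatch_inner
  exact h.not_three hf ((deleteAt_ne_deleteAt_of_le_of_lt (by omega) (by omega)).2 hq) hl
    (by omega) (by omega) (by omega)

theorem le_last_of_forward (C : BalancedPair x y f f₂ l₂ l) (hij : i ≤ j)
    (h : HammingLE 2 (deleteAt i x) (deleteAt j y)) : i ≤ l := by
  by_contra! hi
  have := C.lt_first
  have := C.lt_mid
  have := C.lt_last
  exact h.not_three ((deleteAt_ne_deleteAt_of_lt hij (by omega)).2 C.ne_f)
    ((deleteAt_ne_deleteAt_of_lt hij (by omega)).2 C.ne_f₂)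
    ((deleteAt_ne_deleteAt_of_lt hij hi).2 C.ne_l) (by omega) (by omega) (by omega)

theorem deleteAt_eq_deleteAt_last (C : BalancedPair x y f f₂ l₂ l) (hij : i ≤ j)
    (h : HammingLE 2 (deleteAt i x) (deleteAt j y)) (hi : f < i) (hj : l ≤ j) :
    deleteAt l y = deleteAt j y := by
  have := C.lt_first
  have := C.lt_mid
  have := C.lt_last
  have hil := C.le_last_of_forward hij h
  have hf := (deleteAt_ne_deleteAt_of_lt hij hi).2 C.ne_f
  refine deleteAt_eq_deleteAt hj fun m hlm hmj => ?_
  by_contra hne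
  rw [← C.after (m + 1) (by omega)] at hne
  have hm := (deleteAt_ne_deleteAt_of_le_of_lt (by omega : i ≤ m) hmj).2 (Ne.symm hne)
  rcases le_or_gt i f₂ with hi₂ | hi₂
  · obtain ⟨q, hfq, hql, hq⟩ := C.exists_mismatch
    exact h.not_three hf ((deleteAt_ne_deleteAt_of_le_of_lt (by omega) (by omega)).2 hq) hm
      (by omega) (by omega) (by omega)
  · exact h.not_three hf ((deleteAt_ne_deleteAt_of_lt hij hi₂).2 C.ne_f₂) hm
      (by omega) (by omega) (by omega)

theorem mem_anchoredSet_of_first_lt (C : BalancedPair x y f f₂ l₂ l) (hij : i ≤ j)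
    (hu : HammingLE 1 z (deleteAt i x)) (hv : HammingLE 1 z (deleteAt j y)) (hi : f < i) :
    z ∈ anchoredSet x y l := by
  have h := hu.symm.trans hv
  have hj := (C.le_or_le_of_forward hij h).resolve_left hi.not_ge
  exact ⟨i, C.le_last_of_forward hij h, hu, C.deleteAt_eq_deleteAt_last hij h hi hj ▸ hv⟩

theorem deleteAt_eq_or_eq_of_le_of_le (C : BalancedPair x y f f₂ l₂ l) (hi : i ≤ f) (hj : l ≤ j)
    (h : HammingLE 2 (deleteAt i x) (deleteAt j y)) :
    deleteAt i x = deleteAt f x ∨ deleteAt l y = deleteAt j y := by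
  have := C.lt_first
  obtain ⟨q, hfq, hql, hq⟩ := C.exists_mismatch
  have hqm := (deleteAt_ne_deleteAt_of_le_of_lt (by omega : i ≤ q) (by omega : q < j)).2 hq
  by_contra! hne
  obtain ⟨k, hik, hkf, hk⟩ : ∃ k, i ≤ k ∧ k < f ∧ x k ≠ x (k + 1) := by
    by_contra! hconst
    exact hne.1 (deleteAt_eq_deleteAt hi hconst)
  obtain ⟨m, hlm, hmj, hm⟩ : ∃ m, l ≤ m ∧ m < j ∧ y m ≠ y (m + 1) := by
    by_contra! hconst
    exact hne.2 (deleteAt_eq_deleteAt hj hconst)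
  rw [C.before k hkf] at hk
  rw [← C.after (m + 1) (by omega)] at hm
  exact h.not_three hqm ((deleteAt_ne_deleteAt_of_le_of_lt (by omega) hmj).2 hm.symm)
    ((deleteAt_ne_deleteAt_of_le_of_lt hik (by omega)).2 hk.symm) (by omega) (by omega) (by omega)

theorem forwardSet_subset (C : BalancedPair x y f f₂ l₂ l) :
    forwardSet x y ⊆
      anchoredSet x y l ∪ mirrorHalf '' anchoredSet (Recon.mirror y) (Recon.mirror x) (-f) := by
  rintro z ⟨i, j, hij, hu, hv⟩
  have hu' := hu.mirrorHalf
  have hv' := hv.mirrorHalf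
  rw [mirrorHalf_deleteAt] at hu' hv'
  rcases lt_or_ge f i with hi | hi
  · exact Or.inl (C.mem_anchoredSet_of_first_lt hij hu hv hi)
  rcases lt_or_ge j l with hj | hj
  · exact Or.inr ⟨mirrorHalf z, C.mirror.mem_anchoredSet_of_first_lt (neg_le_neg hij) hv' hu'
      (neg_lt_neg hj), mirrorHalf_mirrorHalf z⟩
  have := C.lt_first
  have := C.lt_mid
  have := C.lt_last
  rcases C.deleteAt_eq_or_eq_of_le_of_le hi hj (hu.symm.trans hv) with heq | heq
  · refine Or.inr ⟨mirrorHalf z, ⟨-j, by omega, hv', ?_⟩, mirrorHalf_mirrorHalf z⟩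
    rwa [← mirrorHalf_deleteAt, ← heq, mirrorHalf_deleteAt]
  · exact Or.inl ⟨i, by omega, hu, heq ▸ hv⟩

theorem encard_forwardSet_le (C : BalancedPair x y f f₂ l₂ l) : (forwardSet x y).encard ≤ 10 := by
  calc (forwardSet x y).encard
      ≤ (anchoredSet x y l ∪
          mirrorHalf '' anchoredSet (Recon.mirror y) (Recon.mirror x) (-f)).encard :=
        Set.encard_le_encard C.forwardSet_subset
    _ ≤ (anchoredSet x y l).encard +
          (mirrorHalf '' anchoredSet (Recon.mirror y) (Recon.mirror x) (-f)).encard :=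
        Set.encard_union_le _ _
    _ ≤ 5 + 5 := add_le_add C.encard_anchoredSet_le
        ((Set.encard_image_le _ _).trans C.mirror.encard_anchoredSet_le)
    _ = 10 := by norm_num

end BalancedPair

section Windows

variable {α : Type*} {x y : ℤ → α} {i j c t f l A : ℤ}

/-- No window of length `t + 1` inside `[f, l]` has period `2`. -/
def Aperiodic (t : ℤ) (x : ℤ → α) (f l : ℤ) : Prop :=
  ∀ a, f ≤ a → a + t ≤ l → ∃ k, a ≤ k ∧ k + 2 ≤ a + t ∧ x k ≠ x (k + 2)

theorem Aperiodic.mirror (h : Aperiodic t x f l) : Aperiodic t (mirror x) (-l) (-f) := by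
  intro a ha hat
  obtain ⟨k, hak, hkt, hk⟩ := h (-a - t) (by omega) (by omega)
  refine ⟨-k - 2, by omega, by omega, ?_⟩
  simp only [Recon.mirror]
  rw [show -(-k - 2) = k + 2 by ring, show -(-k - 2 + 2) = k by ring]
  exact hk.symm

theorem Aperiodic.not_eqOn (h : Aperiodic t x f l) (hc : f ≤ c) (hcl : c + t ≤ l)
    (hs : Set.EqOn (fun m => x (m + 1)) y (Set.Ico c (c + t))) :
    ¬ Set.EqOn x y (Set.Ico c (c + t)) := by
  intro he
  obtain ⟨k, hck, hkt, hk⟩ := h c hc hcl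
  have hk₀ : k ∈ Set.Ico c (c + t) := ⟨hck, by omega⟩
  have hk₁ : k + 1 ∈ Set.Ico c (c + t) := ⟨by omega, by omega⟩
  apply hk
  calc x k = y k := he hk₀
    _ = x (k + 1) := (hs hk₀).symm
    _ = y (k + 1) := he hk₁
    _ = x (k + 1 + 1) := (hs hk₁).symm
    _ = x (k + 2) := by rw [add_assoc, one_add_one_eq_two]

theorem Aperiodic.not_eqOn_shift (h : Aperiodic t x f l) (hc : f ≤ c) (hcl : c + t ≤ l)
    (hs : Set.EqOn (fun m => x (m + 1)) y (Set.Ico c (c + t))) :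
    ¬ Set.EqOn (fun m => y (m + 1)) x (Set.Ico c (c + t)) := by
  intro he
  obtain ⟨k, hck, hkt, hk⟩ := h c hc hcl
  apply hk
  calc x k = y (k + 1) := (he ⟨hck, by omega⟩).symm
    _ = x (k + 1 + 1) := (hs ⟨by omega, by omega⟩).symm
    _ = x (k + 2) := by rw [add_assoc, one_add_one_eq_two]

theorem le_of_forall_interval_meets {B : ℤ} (ht : 0 < t) :
    ∀ (N : ℕ) (E : Finset ℤ) (A : ℤ), E.card ≤ N →
      (∀ c, A < c → c + t ≤ B → ∃ m ∈ E, m ∈ Set.Ico c (c + t)) → B - A ≤ (N + 1) * t := by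
  intro N
  induction N with
  | zero =>
    intro E A hE h
    by_contra! hlt
    obtain ⟨m, hm, -⟩ := h (A + 1) (by omega) (by push_cast at hlt; linarith)
    simp [Finset.card_eq_zero.1 (Nat.le_zero.1 hE)] at hm
  | succ N ih =>
    intro E A hE h
    by_cases hB : B - A ≤ t
    · push_cast
      nlinarith [mul_nonneg (Int.natCast_nonneg N) ht.le]
    obtain ⟨m, hm, hAm⟩ := h (A + 1) (by omega) (by omega)
    have hcard : (E.erase m).card ≤ N := by
      rw [Finset.card_erase_of_mem hm]
      omega
    have := ih (E.erase m) (A + t) hcard fun c hc hcB => by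
      obtain ⟨k, hk, hck⟩ := h c (by omega) hcB
      rw [Set.mem_Ico] at hAm hck
      exact ⟨k, Finset.mem_erase.2 ⟨by omega, hk⟩, hck⟩
    push_cast
    linarith

/-- The position in `y` of the letter number `m` of `deleteAt j y`. -/
def skip (j m : ℤ) : ℤ := if m < j then m else m + 1

theorem eqOn_or_eqOn_shift_of_skip (hij : i ≤ j) (hi : i ≤ c ∨ c + t ≤ i)
    (hj : j < c ∨ c + t ≤ j)
    (h : ∀ m, deleteAt i x m ≠ deleteAt j y m → skip j m ∉ Set.Ico c (c + t)) :
    (Set.EqOn x y (Set.Ico c (c + t)) ∧ (c + t ≤ i ∨ j < c)) ∨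
      Set.EqOn (fun m => x (m + 1)) y (Set.Ico c (c + t)) := by
  rcases hi with hi | hi
  · rcases hj with hj | hj
    · refine Or.inl ⟨fun m hm => ?_, Or.inr hj⟩
      by_contra hne
      refine h (m - 1) ((deleteAt_ne_deleteAt_of_gt hij (hj.trans_le hm.1)).2 hne) ?_
      rwa [skip, if_neg (by have := hm.1; omega), sub_add_cancel]
    · refine Or.inr fun m hm => ?_
      have hmj := hm.2.trans_le hj
      by_contra hne
      refine h m ((deleteAt_ne_deleteAt_of_le_of_lt (hi.trans hm.1) hmj).2 hne) ?_
      rwa [skip, if_pos hmj]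
  · refine Or.inl ⟨fun m hm => ?_, Or.inl hi⟩
    have hmi := hm.2.trans_le hi
    by_contra hne
    refine h m ((deleteAt_ne_deleteAt_of_lt hij hmi).2 hne) ?_
    rwa [skip, if_pos (hmi.trans_le hij)]

-- The deletion points are cuts as well. They cost nothing, as the mismatch that `A` (or `l`)
-- contributes when `A < i` (or `j < l`) lies outside every window and is traded for `i` (or `j`).
theorem exists_cuts (ht : 0 < t) (hij : i ≤ j) (hA : x A ≠ y A) (hl : x l ≠ y l) (D : Finset ℤ)
    (hD : ∀ m, A ≤ m → deleteAt i x m ≠ deleteAt j y m → m ∈ D) :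
    ∃ E : Finset ℤ, E.card ≤ D.card ∧ ∀ c, A < c → c + t ≤ l →
      (∀ m ∈ E, m ∉ Set.Ico c (c + t)) →
      (Set.EqOn x y (Set.Ico c (c + t)) ∧ (c + t ≤ i ∨ j < c)) ∨
        Set.EqOn (fun m => x (m + 1)) y (Set.Ico c (c + t)) := by
  let cut (m : ℤ) : ℤ := if m = A ∧ A < i then i else if m = l - 1 ∧ j ≤ m then j else skip j m
  refine ⟨D.image cut, Finset.card_image_le, fun c hc hcl hE => ?_⟩
  have hcut {m : ℤ} (hm : A ≤ m) (hne : deleteAt i x m ≠ deleteAt j y m) :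
      cut m ∉ Set.Ico c (c + t) := hE _ (Finset.mem_image_of_mem _ (hD m hm hne))
  have hi : i ≤ c ∨ c + t ≤ i := by
    rcases lt_or_ge A i with h | h
    · have := hcut le_rfl ((deleteAt_ne_deleteAt_of_lt hij h).2 hA)
      rw [show cut A = i from if_pos ⟨rfl, h⟩, Set.mem_Ico] at this
      omega
    · omega
  have hj : j < c ∨ c + t ≤ j := by
    rcases lt_or_ge j l with h | h
    · have := hcut (by omega) ((deleteAt_ne_deleteAt_of_gt hij h).2 hl)
      rw [show cut (l - 1) = j from (if_neg (by omega)).trans (if_pos (by omega)),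
        Set.mem_Ico] at this
      omega
    · omega
  refine eqOn_or_eqOn_shift_of_skip hij hi hj fun m hne hm => ?_
  have hAm : A ≤ m ∧ ¬ (m = A ∧ A < i) ∧ ¬ (m = l - 1 ∧ j ≤ m) := by
    simp only [skip, Set.mem_Ico] at hm
    split_ifs at hm <;> omega
  have := hcut hAm.1 hne
  rw [show cut m = skip j m from (if_neg hAm.2.1).trans (if_neg hAm.2.2)] at this
  exact this hm

end Windows

namespace BalancedPair

variable {x y z z' : ℤ → Bool} {f f₂ l₂ l i j i' j' t : ℤ}

theorem second_le_of_backward (C : BalancedPair x y f f₂ l₂ l) (hij' : j' ≤ i')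
    (h' : HammingLE 2 (deleteAt j' y) (deleteAt i' x)) : f₂ ≤ i' := by
  by_contra! hi'
  have := C.lt_mid
  have := C.lt_last
  exact h'.not_three ((deleteAt_ne_deleteAt_of_gt hij' hi').2 C.ne_f₂.symm)
    ((deleteAt_ne_deleteAt_of_gt hij' (by omega)).2 C.ne_l₂.symm)
    ((deleteAt_ne_deleteAt_of_gt hij' (by omega)).2 C.ne_l.symm) (by omega) (by omega) (by omega)

theorem sub_le_of_le_first (C : BalancedPair x y f f₂ l₂ l) (ht : 0 < t)
    (hx : Aperiodic t x f l) (hy : Aperiodic t y f l)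
    (hij : i ≤ j) (h : HammingLE 2 (deleteAt i x) (deleteAt j y))
    (hij' : j' ≤ i') (h' : HammingLE 2 (deleteAt j' y) (deleteAt i' x))
    (hi : i ≤ f₂) (hj : l ≤ j) (hcase : i ≤ f ∨ j' ≤ f) : l - f ≤ 5 * t := by
  have hi' := C.second_le_of_backward hij' h'
  obtain ⟨D, hDcard, hD⟩ := h.exists_finset
  obtain ⟨D', hDcard', hD'⟩ := h'.exists_finset
  obtain ⟨E, hE, hcut⟩ := exists_cuts ht hij C.ne_f C.ne_l D fun m _ => hD m
  obtain ⟨E', hE', hcut'⟩ := exists_cuts ht hij' C.ne_f.symm C.ne_l.symm D' fun m _ => hD' m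
  have hcard : (E ∪ E').card ≤ 4 := (Finset.card_union_le _ _).trans (by omega)
  have := le_of_forall_interval_meets ht 4 (E ∪ E') f hcard fun c hc hcl => by
    by_contra! hmeet
    rcases hcut c hc hcl fun m hm => hmeet m (Finset.mem_union_left _ hm) with he | hs <;>
    rcases hcut' c hc hcl fun m hm => hmeet m (Finset.mem_union_right _ hm) with he' | hs'
    · omega
    · exact hy.not_eqOn hc.le hcl hs' he.1.symm
    · exact hx.not_eqOn hc.le hcl hs he'.1.symm
    · exact hx.not_eqOn_shift hc.le hcl hs hs'
  push_cast at this
  linarith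

theorem sub_le_of_first_lt (C : BalancedPair x y f f₂ l₂ l) (ht : 0 < t)
    (hx : Aperiodic t x f l) (hij : i ≤ j) (h : HammingLE 2 (deleteAt i x) (deleteAt j y))
    (hij' : j' ≤ i') (h' : HammingLE 2 (deleteAt j' y) (deleteAt i' x))
    (hi : i ≤ f₂) (hj : l ≤ j) (hfi : f < i) (hfj' : f < j') : l - f ≤ 6 * t := by
  have := C.lt_first
  obtain ⟨q, hfq, hql, hq⟩ := C.exists_mismatch
  have huniq : ∀ m, f₂ ≤ m → m < l → m ≠ q → x (m + 1) = y m := fun m hfm hml hmq => by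
    by_contra hne
    exact h.not_three ((deleteAt_ne_deleteAt_of_lt hij hfi).2 C.ne_f)
      ((deleteAt_ne_deleteAt_of_le_of_lt (by omega) (by omega)).2 hq)
      ((deleteAt_ne_deleteAt_of_le_of_lt (by omega) (by omega)).2 hne)
      (by omega) (by omega) hmq.symm
  have hqf := C.mismatch_sub_le hfq hql hq huniq
  obtain ⟨D', hDcard', hD'⟩ := h'.exists_finset
  obtain ⟨E', hE', hcut'⟩ := exists_cuts ht hij' C.ne_f₂.symm C.ne_l.symm (D'.erase f)
    fun m hm hne => Finset.mem_erase.2 ⟨by omega, hD' m hne⟩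
  rw [Finset.card_erase_of_mem
    (hD' f ((deleteAt_ne_deleteAt_of_lt hij' hfj').2 C.ne_f.symm))] at hE'
  have hcard : (insert q E').card ≤ 2 := (Finset.card_insert_le _ _).trans (by omega)
  have := le_of_forall_interval_meets ht 2 (insert q E') f₂ hcard fun c hc hcl => by
    by_contra! hmeet
    have hcq := hmeet q (Finset.mem_insert_self _ _)
    have hs : Set.EqOn (fun m => x (m + 1)) y (Set.Ico c (c + t)) := fun m hm =>
      huniq m (hc.le.trans hm.1) (hm.2.trans_le hcl) fun hmq => hcq (hmq ▸ hm)
    rcases hcut' c hc hcl fun m hm => hmeet m (Finset.mem_insert_of_mem hm) with he' | hs'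
    · exact hx.not_eqOn (by omega) hcl hs he'.1.symm
    · exact hx.not_eqOn_shift (by omega) hcl hs hs'
  push_cast at this
  linarith

theorem second_lt_of_long (C : BalancedPair x y f f₂ l₂ l) (ht : 0 < t)
    (hx : Aperiodic t x f l) (hy : Aperiodic t y f l) (hlong : 6 * t < l - f)
    (hij : i ≤ j) (h : HammingLE 2 (deleteAt i x) (deleteAt j y))
    (hij' : j' ≤ i') (h' : HammingLE 2 (deleteAt j' y) (deleteAt i' x)) (hj : l ≤ j) :
    f₂ < i := by
  by_contra! hi
  by_cases hcase : i ≤ f ∨ j' ≤ f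
  · have := C.sub_le_of_le_first ht hx hy hij h hij' h' hi hj hcase
    omega
  · push Not at hcase
    have := C.sub_le_of_first_lt ht hx hij h hij' h' hi hj hcase.1 hcase.2
    omega

theorem eq_update_of_second_lt (C : BalancedPair x y f f₂ l₂ l) (hij : i ≤ j)
    (hu : HammingLE 1 z (deleteAt i x)) (hv : HammingLE 1 z (deleteAt j y)) (hi : f₂ < i)
    (hj : l ≤ j) :
    z = Function.update (deleteAt l y) f (!deleteAt l y f) ∨
      z = Function.update (deleteAt l y) f₂ (!deleteAt l y f₂) := by
  have hfi := C.lt_first.trans hi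
  rw [C.deleteAt_eq_deleteAt_last hij (hu.symm.trans hv) hfi hj]
  exact hu.eq_update_of_ne_of_ne hv C.lt_first.ne
    ((deleteAt_ne_deleteAt_of_lt hij hfi).2 C.ne_f) ((deleteAt_ne_deleteAt_of_lt hij hi).2 C.ne_f₂)

theorem encard_forwardSet_le_four (C : BalancedPair x y f f₂ l₂ l) (ht : 0 < t)
    (hx : Aperiodic t x f l) (hy : Aperiodic t y f l) (hlong : 6 * t < l - f)
    (hne : (forwardSet y x).Nonempty) : (forwardSet x y).encard ≤ 4 := by
  classical
  obtain ⟨z', j', i', hij', hu', hv'⟩ := hne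
  have h' := hu'.symm.trans hv'
  let v := deleteAt l y
  let w := deleteAt (-f) (Recon.mirror x)
  have hsub : forwardSet x y ⊆ (({Function.update v f (!v f), Function.update v f₂ (!v f₂),
      mirrorHalf (Function.update w (-l) (!w (-l))),
      mirrorHalf (Function.update w (-l₂) (!w (-l₂)))} : Finset (ℤ → Bool)) : Set _) := by
    rintro z ⟨i, j, hij, hu, hv⟩
    have h := hu.symm.trans hv
    simp only [Finset.coe_insert, Finset.coe_singleton, Set.mem_insert_iff, Set.mem_singleton_iff]
    rcases C.le_or_le_of_forward hij h with hi | hj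
    · have hj := C.mirror.second_lt_of_long ht hy.mirror hx.mirror (by omega) (neg_le_neg hij)
        h.symm.mirror_deleteAt (neg_le_neg hij') h'.symm.mirror_deleteAt (neg_le_neg hi)
      have hu := hu.mirrorHalf
      have hv := hv.mirrorHalf
      rw [mirrorHalf_deleteAt] at hu hv
      rcases C.mirror.eq_update_of_second_lt (neg_le_neg hij) hv hu hj (neg_le_neg hi) with hz | hz
      · exact Or.inr (Or.inr (Or.inl (by rw [← hz, mirrorHalf_mirrorHalf])))
      · exact Or.inr (Or.inr (Or.inr (by rw [← hz, mirrorHalf_mirrorHalf])))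
    · have hi := C.second_lt_of_long ht hx hy hlong hij h hij' h' hj
      rcases C.eq_update_of_second_lt hij hu hv hi hj with hz | hz
      · exact Or.inl hz
      · exact Or.inr (Or.inl hz)
  refine (Set.encard_le_encard hsub).trans ?_
  rw [Set.encard_coe_eq_coe_finsetCard]
  exact_mod_cast Finset.card_le_four

theorem encard_forwardSet_union_le (C : BalancedPair x y f f₂ l₂ l) (ht : 0 < t)
    (hx : Aperiodic t x f l) (hy : Aperiodic t y f l) (hlong : 6 * t < l - f) :
    (forwardSet x y ∪ forwardSet y x).encard ≤ 10 := by
  rcases (forwardSet x y).eq_empty_or_nonempty with h | h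
  · rw [h, Set.empty_union]
    exact C.symm.encard_forwardSet_le
  rcases (forwardSet y x).eq_empty_or_nonempty with h' | h'
  · rw [h', Set.union_empty]
    exact C.encard_forwardSet_le
  calc (forwardSet x y ∪ forwardSet y x).encard
      ≤ (forwardSet x y).encard + (forwardSet y x).encard := Set.encard_union_le _ _
    _ ≤ 4 + 4 := add_le_add (C.encard_forwardSet_le_four ht hx hy hlong h')
        (C.symm.encard_forwardSet_le_four ht hy hx hlong h)
    _ ≤ 10 := by norm_num

end BalancedPair

section SuffixSums

variable {x y z u v : ℤ → Bool} {n m i j : ℤ}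

/-- The weight of `x` minus the weight of `y` on the positions `m ≤ k < n`; VT syndromes of all
orders are moments of this function of `m`. -/
noncomputable def suffixDiff (x y : ℤ → Bool) (n m : ℤ) : ℤ :=
  ∑ k ∈ Finset.Ico m n, (bit x k - bit y k)

theorem suffixDiff_swap (x y : ℤ → Bool) (n m : ℤ) : suffixDiff y x n m = -suffixDiff x y n m := by
  simp only [suffixDiff, ← Finset.sum_neg_distrib, neg_sub]

theorem suffixDiff_add_suffixDiff (x y z : ℤ → Bool) (n m : ℤ) :
    suffixDiff x y n m + suffixDiff y z n m = suffixDiff x z n m := by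
  simp only [suffixDiff, ← Finset.sum_add_distrib, sub_add_sub_cancel]

theorem suffixDiff_eq_add (x y : ℤ → Bool) (h : m < n) :
    suffixDiff x y n m = bit x m - bit y m + suffixDiff x y n (m + 1) :=
  sum_Ico_eq_add_sum_Ico _ h

theorem suffixDiff_eq_of_eq_right {n₁ n₂ : ℤ} (h₁ : ∀ k, n₁ ≤ k → x k = y k)
    (h₂ : ∀ k, n₂ ≤ k → x k = y k) (m : ℤ) : suffixDiff x y n₁ m = suffixDiff x y n₂ m := by
  wlog hn : n₁ ≤ n₂ generalizing n₁ n₂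
  · exact (this h₂ h₁ (le_of_not_ge hn)).symm
  refine Finset.sum_subset (Finset.Ico_subset_Ico_right hn) fun k hk hk' => ?_
  rw [Finset.mem_Ico] at hk hk'
  exact bit_sub_eq_zero (h₁ k (by omega))

theorem suffixDiff_eq_of_eq_left {m₁ m₂ : ℤ} (hm : m₁ ≤ m₂) (h : ∀ k < m₂, x k = y k) (n : ℤ) :
    suffixDiff x y n m₁ = suffixDiff x y n m₂ := by
  refine (Finset.sum_subset (Finset.Ico_subset_Ico_left hm) fun k hk hk' => ?_).symm
  rw [Finset.mem_Ico] at hk hk'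
  exact bit_sub_eq_zero (h k (by omega))

theorem sum_bit_eq_of_le (hin : i < n) (hm : m ≤ i) :
    ∑ k ∈ Finset.Ico m n, bit x k =
      bit x i + ∑ k ∈ Finset.Ico m (n - 1), bit (deleteAt i x) k := by
  have hleft : ∑ k ∈ Finset.Ico m i, bit (deleteAt i x) k = ∑ k ∈ Finset.Ico m i, bit x k :=
    Finset.sum_congr rfl fun k hk =>
      bit_eq_bit_iff.2 (deleteAt_of_lt x (Finset.mem_Ico.1 hk).2)
  have hright : ∑ k ∈ Finset.Ico i (n - 1), bit (deleteAt i x) k =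
      ∑ k ∈ Finset.Ico (i + 1) n, bit x k := by
    rw [← sub_add_cancel n 1, ← Finset.sum_Ico_add', sub_add_cancel]
    exact Finset.sum_congr rfl fun k hk =>
      bit_eq_bit_iff.2 (deleteAt_of_le x (Finset.mem_Ico.1 hk).1)
  rw [sum_Ico_split _ hm hin.le, sum_Ico_eq_add_sum_Ico _ hin,
    sum_Ico_split _ hm (by omega : i ≤ n - 1), hleft, hright]
  ring

theorem sum_bit_eq_of_lt (hm : i < m) (n : ℤ) :
    ∑ k ∈ Finset.Ico m n, bit x k = ∑ k ∈ Finset.Ico (m - 1) (n - 1), bit (deleteAt i x) k := by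
  rw [← sub_add_cancel m 1, ← sub_add_cancel n 1, ← Finset.sum_Ico_add', sub_add_cancel,
    sub_add_cancel]
  refine Finset.sum_congr rfl fun k hk => (bit_eq_bit_iff.2 (deleteAt_of_le x ?_)).symm
  rw [Finset.mem_Ico] at hk
  omega

-- The lower limit on the right depends on `j` only, so that the sums for `x` and `y` can be
-- subtracted from each other.
theorem sum_bit_eq (hij : i ≤ j) (hjn : j < n) (m : ℤ) :
    ∑ k ∈ Finset.Ico m n, bit x k = (if m ≤ j then bit x (max i m) else 0) +
      ∑ k ∈ Finset.Ico (if m ≤ j then m else m - 1) (n - 1), bit (deleteAt i x) k := by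
  rcases le_or_gt m j with hmj | hmj
  · rw [if_pos hmj, if_pos hmj]
    rcases le_or_gt m i with hmi | hmi
    · rw [max_eq_left hmi, sum_bit_eq_of_le (hij.trans_lt hjn) hmi]
    · rw [max_eq_right hmi.le, sum_bit_eq_of_lt hmi, sum_Ico_eq_add_sum_Ico _ (by omega),
        sub_add_cancel, add_left_inj, bit_eq_bit_iff, deleteAt_of_le x (by omega), sub_add_cancel]
  · rw [if_neg hmj.not_ge, if_neg hmj.not_ge, zero_add, sum_bit_eq_of_lt (hij.trans_lt hmj)]

theorem suffixDiff_eq_add_deleteAt (hij : i ≤ j) (hjn : j < n) (m : ℤ) :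
    suffixDiff x y n m = (if m ≤ j then bit x (max i m) - bit y j else 0) +
      suffixDiff (deleteAt i x) (deleteAt j y) (n - 1) (if m ≤ j then m else m - 1) := by
  simp only [suffixDiff, Finset.sum_sub_distrib, sum_bit_eq (x := x) hij hjn,
    sum_bit_eq (x := y) le_rfl hjn]
  split_ifs with hm
  · rw [max_eq_left hm]
    ring
  · ring

theorem HammingLE.exists_suffixDiff_eq (h : HammingLE 1 u v) (n : ℤ) :
    ∃ a p : ℤ, |a| ≤ 1 ∧ ∀ m, suffixDiff u v n m = if m ≤ p then a else 0 := by
  by_cases hp : ∃ p < n, u p ≠ v p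
  · obtain ⟨p, hpn, hp⟩ := hp
    refine ⟨bit u p - bit v p, p, ?_, fun m => ?_⟩
    · rcases bit_sub_of_ne hp with h | h <;> rw [h] <;> decide
    · rw [suffixDiff, ← Finset.sum_filter_of_ne (p := (· = p)), Finset.sum_filter,
        Finset.sum_ite_eq']
      · simp only [Finset.mem_Ico, hpn, and_true]
      · exact fun k _ hk => h.eq_of_ne (fun h => hk (bit_sub_eq_zero h)) hp
  · push Not at hp
    refine ⟨0, 0, by decide, fun m => ?_⟩
    rw [ite_self]
    exact Finset.sum_eq_zero fun k hk => bit_sub_eq_zero (hp k (Finset.mem_Ico.1 hk).2)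

theorem le_skip_iff {p : ℤ} : m ≤ skip j p ↔ (if m ≤ j then m else m - 1) ≤ p := by
  rw [skip]
  split_ifs <;> omega

theorem exists_steps (hij : i ≤ j) (hjn : j < n) (hu : HammingLE 1 z (deleteAt i x))
    (hv : HammingLE 1 z (deleteAt j y)) :
    ∃ a b p q : ℤ, |a| ≤ 1 ∧ |b| ≤ 1 ∧ ∀ m,
      (if m ≤ p then a else 0) + (if m ≤ q then b else 0) - bit y j ≤ suffixDiff x y n m ∧
      suffixDiff x y n m ≤ (if m ≤ p then a else 0) + (if m ≤ q then b else 0) - bit y j + 1 := by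
  obtain ⟨a, p, ha, hp⟩ := hu.symm.exists_suffixDiff_eq (n - 1)
  obtain ⟨b, q, hb, hq⟩ := hv.exists_suffixDiff_eq (n - 1)
  refine ⟨a, b, skip j p, skip j q, ha, hb, fun m => ?_⟩
  rw [suffixDiff_eq_add_deleteAt hij hjn, ← suffixDiff_add_suffixDiff _ z, hp, hq]
  simp only [le_skip_iff]
  have := bit_nonneg x (max i m)
  have := bit_le_one x (max i m)
  have := bit_nonneg y j
  have := bit_le_one y j
  rcases le_or_gt m j with hm | hm
  · rw [if_pos hm, if_pos hm]
    omega
  · rw [if_neg hm.not_ge, if_neg hm.not_ge]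
    omega

theorem abs_suffixDiff_le_three (hin : i < n) (hjn : j < n) (hu : HammingLE 1 z (deleteAt i x))
    (hv : HammingLE 1 z (deleteAt j y)) (m : ℤ) : |suffixDiff x y n m| ≤ 3 := by
  wlog hij : i ≤ j generalizing x y i j
  · rw [← abs_neg, ← suffixDiff_swap]
    exact this hjn hin hv hu (le_of_not_ge hij)
  obtain ⟨a, b, p, q, ha, hb, h⟩ := exists_steps hij hjn hu hv
  have := h m
  have := bit_nonneg y j
  have := bit_le_one y j
  rw [abs_le] at ha hb ⊢
  split_ifs at * <;> omega

end SuffixSums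

section SignChanges

variable {S : ℤ → ℤ} {s₀ : ℤ} {N : ℕ}

/-- The values of `S` are at most `2` in absolute value and change sign at most twice, namely
after `c` and after `d`. -/
def FewSignChanges (S : ℤ → ℤ) : Prop :=
  ∃ s c d : ℤ, (s = 1 ∨ s = -1) ∧ c ≤ d ∧ ∀ m,
    |S m| ≤ 2 ∧ (c < m → m ≤ d → s * S m ≤ 0) ∧ (m ≤ c ∨ d < m → 0 ≤ s * S m)

theorem FewSignChanges.neg (h : FewSignChanges S) : FewSignChanges (fun m => -S m) := by
  obtain ⟨s, c, d, hs, hcd, h⟩ := h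
  exact ⟨-s, c, d, by omega, hcd, fun m => by simpa only [abs_neg, neg_mul_neg] using h m⟩

theorem fewSignChanges_of_steps {a b p q r : ℤ} (ha : |a| ≤ 1) (hb : |b| ≤ 1)
    (hS : ∀ m, (if m ≤ p then a else 0) + (if m ≤ q then b else 0) ≤ S m ∧
      S m ≤ (if m ≤ p then a else 0) + (if m ≤ q then b else 0) + 1)
    (h0 : ∀ m ≤ r, S m = 0) : FewSignChanges S := by
  have hab : -1 ≤ a + b ∧ a + b ≤ 0 := by
    have h := hS (min r (min p q))
    rw [h0 _ (min_le_left _ _), if_pos (by omega), if_pos (by omega)] at h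
    omega
  suffices h : ∃ c d : ℤ, c ≤ d ∧ ∀ m, (-2 ≤ S m ∧ S m ≤ 2) ∧
      (c < m → m ≤ d → S m ≤ 0) ∧ (m ≤ c ∨ d < m → 0 ≤ S m) by
    obtain ⟨c, d, hcd, h⟩ := h
    exact ⟨1, c, d, Or.inl rfl, hcd, by simpa only [one_mul, abs_le] using h⟩
  rw [abs_le] at ha hb
  have hcases : (a = 0 ∧ b = 0) ∨ (a = 0 ∧ b = -1) ∨ (a = -1 ∧ b = 0) ∨ (a = 1 ∧ b = -1) ∨
      (a = -1 ∧ b = 1) := by omega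
  rcases hcases with ⟨rfl, rfl⟩ | ⟨rfl, rfl⟩ | ⟨rfl, rfl⟩ | ⟨rfl, rfl⟩ | ⟨rfl, rfl⟩
  · refine ⟨0, 0, le_rfl, fun m => ?_⟩
    have := hS m
    simp only [ite_self] at this
    omega
  · refine ⟨min r q, q, min_le_right _ _, fun m => ?_⟩
    have := hS m
    have := h0 m
    split_ifs at * <;> omega
  · refine ⟨min r p, p, min_le_right _ _, fun m => ?_⟩
    have := hS m
    have := h0 m
    split_ifs at * <;> omega
  · refine ⟨p, max p q, le_max_left _ _, fun m => ?_⟩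
    have := hS m
    split_ifs at * <;> omega
  · refine ⟨q, max q p, le_max_left _ _, fun m => ?_⟩
    have := hS m
    split_ifs at * <;> omega

theorem fewSignChanges_suffixDiff {x y z : ℤ → Bool} {n i j : ℤ} (hin : i < n) (hjn : j < n)
    (hu : HammingLE 1 z (deleteAt i x)) (hv : HammingLE 1 z (deleteAt j y)) {r : ℤ}
    (h0 : ∀ m ≤ r, suffixDiff x y n m = 0) : FewSignChanges (suffixDiff x y n) := by
  wlog hij : i ≤ j generalizing x y i j
  · have h := (this hjn hin hv hu (fun m hm => by rw [suffixDiff_swap, h0 m hm, neg_zero])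
      (le_of_not_ge hij)).neg
    simpa only [← suffixDiff_swap] using h
  obtain ⟨a, b, p, q, ha, hb, h⟩ := exists_steps hij hjn hu hv
  rcases bit_eq_zero_or_one y j with hyj | hyj
  · exact fewSignChanges_of_steps ha hb (by simpa only [hyj, sub_zero] using h) h0
  · have hneg : FewSignChanges (fun m => -suffixDiff x y n m) := by
      refine fewSignChanges_of_steps (a := -a) (b := -b) (p := p) (q := q) (r := r)
        (by rwa [abs_neg]) (by rwa [abs_neg]) (fun m => ?_) fun m hm => by rw [h0 m hm, neg_zero]
      have := h m
      split_ifs at * <;> omega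
    simpa only [neg_neg] using hneg.neg

-- With the sign changes at `c` and `d`, the quadratic weight
-- `w m = (2 * m - 2 * c - 1) * (2 * m - 2 * d - 1)` makes all products `w m * S m` of one sign,
-- while their sum is a combination of the moments.
theorem FewSignChanges.eq_zero (h : FewSignChanges S)
    (hmom : ∀ k < 3, ∑ r ∈ Finset.range N, ((r : ℤ) + 1) ^ k * S (s₀ + r) = 0) :
    ∀ r < N, S (s₀ + r) = 0 := by
  obtain ⟨s, c, d, hs, hcd, h⟩ := h
  let w : ℤ → ℤ := fun m => (2 * m - 2 * c - 1) * (2 * m - 2 * d - 1)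
  have hnonneg (m : ℤ) : 0 ≤ w m * (s * S m) := by
    obtain ⟨-, hmid, hout⟩ := h m
    rcases le_or_gt m c with hc | hc
    · exact mul_nonneg (mul_nonneg_of_nonpos_of_nonpos (by omega) (by omega)) (hout (Or.inl hc))
    rcases le_or_gt m d with hd | hd
    · exact mul_nonneg_of_nonpos_of_nonpos
        (mul_nonpos_of_nonneg_of_nonpos (by omega) (by omega)) (hmid hc hd)
    · exact mul_nonneg (mul_nonneg (by omega) (by omega)) (hout (Or.inr hd))
  have hsum : ∑ r ∈ Finset.range N, w (s₀ + r) * (s * S (s₀ + r)) = 0 := by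
    let A : ℤ := 2 * s₀ - 2 * c - 3
    let B : ℤ := 2 * s₀ - 2 * d - 3
    calc ∑ r ∈ Finset.range N, w (s₀ + r) * (s * S (s₀ + r))
        = s * A * B * ∑ r ∈ Finset.range N, ((r : ℤ) + 1) ^ 0 * S (s₀ + r) +
          2 * s * (A + B) * ∑ r ∈ Finset.range N, ((r : ℤ) + 1) ^ 1 * S (s₀ + r) +
          4 * s * ∑ r ∈ Finset.range N, ((r : ℤ) + 1) ^ 2 * S (s₀ + r) := by
          simp only [Finset.mul_sum, ← Finset.sum_add_distrib]
          refine Finset.sum_congr rfl fun r _ => ?_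
          simp only [w, A, B]
          ring
      _ = 0 := by
          rw [hmom 0 (by norm_num), hmom 1 (by norm_num), hmom 2 (by norm_num)]
          ring
  intro r hr
  have hr0 := (Finset.sum_eq_zero_iff_of_nonneg fun r _ => hnonneg _).1 hsum r
    (Finset.mem_range.2 hr)
  have hw : w (s₀ + r) ≠ 0 := mul_ne_zero (by omega) (by omega)
  have hs' : s ≠ 0 := by omega
  simpa only [mul_eq_zero, hw, hs', false_or] using hr0

theorem FewSignChanges.abs_moment_le (h : FewSignChanges S) (s₀ : ℤ) (N k : ℕ) :
    |∑ r ∈ Finset.range N, ((r : ℤ) + 1) ^ k * S (s₀ + r)| ≤ 2 * (N : ℤ) ^ (k + 1) := by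
  obtain ⟨s, c, d, -, -, h⟩ := h
  calc |∑ r ∈ Finset.range N, ((r : ℤ) + 1) ^ k * S (s₀ + r)|
      ≤ ∑ r ∈ Finset.range N, |((r : ℤ) + 1) ^ k * S (s₀ + r)| := Finset.abs_sum_le_sum_abs _ _
    _ ≤ ∑ r ∈ Finset.range N, (N : ℤ) ^ k * 2 := Finset.sum_le_sum fun r hr => by
        rw [Finset.mem_range] at hr
        rw [abs_mul, abs_of_nonneg (by positivity)]
        exact mul_le_mul (pow_le_pow_left₀ (by positivity) (by omega) k) (h _).1 (abs_nonneg _)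
          (by positivity)
    _ = 2 * (N : ℤ) ^ (k + 1) := by
        rw [Finset.sum_const, Finset.card_range, nsmul_eq_mul]
        ring

end SignChanges

section Lists

variable {x y z : List Bool}

/-- The list `x` as a two-sided infinite word: its first letter is at position `0`, and it is
padded with `false` on both sides. -/
def pad (x : List Bool) : ℤ → Bool := fun m => if 0 ≤ m then x.getD m.toNat false else false

theorem pad_natCast (x : List Bool) (k : ℕ) : pad x k = x.getD k false := by
  simp only [pad, Int.natCast_nonneg, if_true, Int.toNat_natCast]

theorem pad_of_neg (x : List Bool) {m : ℤ} (h : m < 0) : pad x m = false := if_neg h.not_ge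

theorem pad_of_length_le (x : List Bool) {m : ℤ} (h : x.length ≤ m) : pad x m = false := by
  lift m to ℕ using by omega
  rw [pad_natCast, List.getD_eq_default _ _ (by exact_mod_cast h)]

theorem eq_of_pad_eq (hlen : x.length = y.length) (h : pad x = pad y) : x = y := by
  refine List.ext_getElem hlen fun k hk hk' => ?_
  have hkey := congrFun h k
  rwa [pad_natCast, pad_natCast, List.getD_eq_getElem _ _ hk, List.getD_eq_getElem _ _ hk']
    at hkey

theorem pad_eraseIdx (x : List Bool) (i : ℕ) : pad (x.eraseIdx i) = deleteAt i (pad x) := by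
  funext m
  rcases lt_or_ge m 0 with hm | hm
  · rw [pad_of_neg _ hm, deleteAt_of_lt _ (by omega), pad_of_neg _ hm]
  lift m to ℕ using hm
  rw [pad_natCast, List.getD_eq_getElem?_getD, List.getElem?_eraseIdx]
  split_ifs with h
  · rw [deleteAt_of_lt _ (by exact_mod_cast h), pad_natCast, List.getD_eq_getElem?_getD]
  · rw [deleteAt_of_le _ (by exact_mod_cast not_lt.1 h), ← Nat.cast_succ, pad_natCast,
      List.getD_eq_getElem?_getD]

theorem exists_eq_eraseIdx_of_sublist {α : Type*} {y x : List α} (h : y.Sublist x)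
    (hlen : y.length + 1 = x.length) : ∃ i < x.length, y = x.eraseIdx i := by
  induction h with
  | slnil => simp at hlen
  | @cons y x a h =>
    have hyx : y = x := h.eq_of_length (by simpa using hlen)
    exact ⟨0, by simp, by simp [hyx]⟩
  | @cons_cons y x a h ih =>
    obtain ⟨i, hi, rfl⟩ := ih (by simpa using hlen)
    exact ⟨i + 1, by simpa using hi, by simp⟩

theorem hammingLE_hdist_getD : ∀ {u v : List Bool}, u.length = v.length →
    HammingLE (hdist u v) (u.getD · false) (v.getD · false)
  | [], [], _ => by simp [HammingLE]
  | a :: u, b :: v, hlen => by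
    have ih := hammingLE_hdist_getD (u := u) (v := v) (by simpa using hlen)
    have hsub : {m | (a :: u).getD m false ≠ (b :: v).getD m false} ⊆
        Nat.succ '' {m | u.getD m false ≠ v.getD m false} ∪ (if a = b then ∅ else {0}) := by
      rintro (_ | m) hm
      · exact Or.inr (by rw [if_neg (by simpa using hm)]; rfl)
      · exact Or.inl ⟨m, by simpa using hm, rfl⟩
    refine (Set.encard_le_encard hsub).trans ((Set.encard_union_le _ _).trans ?_)
    rw [Nat.succ_injective.encard_image, hdist, List.zip_cons_cons, List.countP_cons, Nat.cast_add]
    refine add_le_add ih ?_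
    by_cases hab : a = b <;> simp [hab]

theorem hammingLE_pad {u v : List Bool} (hlen : u.length = v.length) :
    HammingLE (hdist u v) (pad u) (pad v) := by
  have hsub : {m | pad u m ≠ pad v m} ⊆
      Nat.cast '' {k : ℕ | u.getD k false ≠ v.getD k false} := by
    intro m hm
    rcases lt_or_ge m 0 with h | h
    · exact absurd ((pad_of_neg u h).trans (pad_of_neg v h).symm) hm
    lift m to ℕ using h
    exact ⟨m, by simpa only [Set.mem_ofPred_eq, pad_natCast] using hm, rfl⟩
  calc {m | pad u m ≠ pad v m}.encard
      ≤ (Nat.cast '' {k : ℕ | u.getD k false ≠ v.getD k false} : Set ℤ).encard :=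
        Set.encard_le_encard hsub
    _ = {k : ℕ | u.getD k false ≠ v.getD k false}.encard := Nat.cast_injective.encard_image _
    _ ≤ hdist u v := hammingLE_hdist_getD hlen

theorem exists_hammingLE_of_mem_dsBall (h : z ∈ dsBall x) :
    ∃ i : ℤ, i < x.length ∧ HammingLE 1 (pad z) (deleteAt i (pad x)) := by
  obtain ⟨y, ⟨hlen, hsub⟩, hz, hd⟩ := h
  obtain ⟨i, hi, rfl⟩ := exists_eq_eraseIdx_of_sublist hsub hlen
  refine ⟨i, by exact_mod_cast hi, ?_⟩
  rw [← pad_eraseIdx]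
  exact le_trans (α := ℕ∞) (hammingLE_pad hz.symm).symm (Nat.cast_le.2 hd)

theorem length_of_mem_dsBall (h : z ∈ dsBall x) : z.length + 1 = x.length := by
  obtain ⟨y, ⟨hlen, -⟩, hz, -⟩ := h
  rw [hz, hlen]

theorem encard_dsBall_inter_le (x y : List Bool) :
    (dsBall x ∩ dsBall y).encard ≤
      (forwardSet (pad x) (pad y) ∪ forwardSet (pad y) (pad x)).encard := by
  have hinj : Set.InjOn pad (dsBall x ∩ dsBall y) := fun u hu v hv =>
    eq_of_pad_eq (Nat.add_right_cancel
      ((length_of_mem_dsBall hu.1).trans (length_of_mem_dsBall hv.1).symm))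
  rw [← hinj.encard_image]
  refine Set.encard_le_encard ?_
  rintro _ ⟨z, ⟨hx, hy⟩, rfl⟩
  obtain ⟨i, -, hi⟩ := exists_hammingLE_of_mem_dsBall hx
  obtain ⟨j, -, hj⟩ := exists_hammingLE_of_mem_dsBall hy
  rcases le_total i j with h | h
  · exact Or.inl ⟨i, j, h, hi, hj⟩
  · exact Or.inr ⟨j, i, h, hj, hi⟩

end Lists

section Syndromes

variable {x y : List Bool} {n : ℕ}

theorem sum_Ico_natCast (g : ℤ → ℤ) (a b : ℕ) :
    ∑ c ∈ Finset.Ico (a : ℤ) b, g c = ∑ c ∈ Finset.Ico a b, g (c : ℕ) := by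
  refine (Finset.sum_nbij' (fun c : ℕ => (c : ℤ)) Int.toNat ?_ ?_ ?_ ?_ fun _ _ => rfl).symm <;>
    simp only [Finset.mem_Ico] <;> omega

theorem bit_pad_natCast (x : List Bool) (i : ℕ) : bit (pad x) i = (x.getD i false).toNat := by
  rw [bit, pad_natCast]

theorem vt_zero_eq (hx : x.length = n) :
    (vt 0 x : ℤ) = ∑ c ∈ Finset.Ico (0 : ℤ) n, bit (pad x) c := by
  rw [← Nat.cast_zero (R := ℤ), sum_Ico_natCast, Nat.Ico_zero_eq_range, Finset.sum_range, vt]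
  subst hx
  simp only [bit_pad_natCast, Nat.cast_sum, List.get_eq_getElem, Fin.is_lt, List.getD_eq_getElem]

theorem vt_zero_sub (hx : x.length = n) (hy : y.length = n) :
    (vt 0 x : ℤ) - vt 0 y = suffixDiff (pad x) (pad y) n 0 := by
  rw [vt_zero_eq hx, vt_zero_eq hy, suffixDiff, Finset.sum_sub_distrib]

theorem vt_succ_eq_sum_range (k : ℕ) (x : List Bool) :
    (vt (k + 1) x : ℤ) = ∑ c ∈ Finset.range x.length,
      ∑ r ∈ Finset.range (c + 1), ((r : ℤ) + 1) ^ k * bit (pad x) c := by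
  have hIcc (c : ℕ) : Finset.Icc 1 (c + 1) = Finset.Ico (0 + 1) (c + 1 + 1) := by
    ext
    simp only [Finset.mem_Icc, Finset.mem_Ico]
    omega
  simp only [vt, Finset.sum_range, bit_pad_natCast, hIcc, ← Finset.sum_Ico_add',
    Nat.Ico_zero_eq_range]
  simp

theorem vt_succ_eq {M : ℕ} (k : ℕ) (hM : x.length ≤ M) :
    (vt (k + 1) x : ℤ) = ∑ r ∈ Finset.range M,
      ((r : ℤ) + 1) ^ k * ∑ c ∈ Finset.Ico (r : ℤ) M, bit (pad x) c := by
  have hext : (vt (k + 1) x : ℤ) = ∑ c ∈ Finset.range M,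
      ∑ r ∈ Finset.range (c + 1), ((r : ℤ) + 1) ^ k * bit (pad x) c := by
    rw [vt_succ_eq_sum_range]
    refine Finset.sum_subset (Finset.range_subset_range.2 hM) fun c _ hc => ?_
    refine Finset.sum_eq_zero fun r _ => ?_
    rw [bit, pad_of_length_le x (by simpa using hc)]
    exact mul_zero _
  rw [hext]
  simp only [sum_Ico_natCast, Finset.mul_sum]
  refine Finset.sum_comm' fun c r => ?_
  simp only [Finset.mem_range, Finset.mem_Ico]
  omega

theorem pad_drop_take (x : List Bool) (s M : ℕ) {c : ℤ} (hc : 0 ≤ c) (hcM : c < M) :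
    pad ((x.drop s).take M) c = pad x (c + s) := by
  lift c to ℕ using hc
  rw [← Nat.cast_add, pad_natCast, pad_natCast, List.getD_eq_getElem?_getD,
    List.getD_eq_getElem?_getD, List.getElem?_take_of_lt (by omega), List.getElem?_drop,
    add_comm c s]

theorem vt_drop_take_sub (x y : List Bool) (s M k : ℕ) :
    (vt (k + 1) ((x.drop s).take M) : ℤ) - vt (k + 1) ((y.drop s).take M) =
      ∑ r ∈ Finset.range M, ((r : ℤ) + 1) ^ k * suffixDiff (pad x) (pad y) (s + M) (s + r) := by
  rw [vt_succ_eq k (List.length_take_le _ _), vt_succ_eq k (List.length_take_le _ _),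
    ← Finset.sum_sub_distrib]
  refine Finset.sum_congr rfl fun r _ => ?_
  have hshift (w : List Bool) : ∑ c ∈ Finset.Ico (r : ℤ) M, bit (pad ((w.drop s).take M)) c =
      ∑ c ∈ Finset.Ico (s + r : ℤ) (s + M), bit (pad w) c := by
    rw [add_comm (s : ℤ) r, add_comm (s : ℤ) M, ← Finset.sum_Ico_add']
    refine Finset.sum_congr rfl fun c hc => bit_eq_bit_iff.2 ?_
    rw [Finset.mem_Ico] at hc
    exact pad_drop_take w s M (by omega) hc.2
  rw [hshift, hshift, ← mul_sub, suffixDiff, Finset.sum_sub_distrib]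

theorem vt_one_sub (hx : x.length = n) (hy : y.length = n) :
    (vt 1 x : ℤ) - vt 1 y = ∑ r ∈ Finset.range n, suffixDiff (pad x) (pad y) n r := by
  have h := vt_drop_take_sub x y 0 n 0
  simpa only [List.drop_zero, List.take_of_length_le hx.le, List.take_of_length_le hy.le, pow_zero,
    one_mul, Nat.cast_zero, zero_add] using h

theorem vt_one_eq (hx : x.length = n) :
    (vt 1 x : ℤ) = ∑ c ∈ Finset.Ico (0 : ℤ) n, (c + 1) * bit (pad x) c := by
  rw [← Nat.cast_zero (R := ℤ), sum_Ico_natCast, Nat.Ico_zero_eq_range, vt_succ_eq_sum_range, hx]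
  simp only [pow_zero, one_mul, Finset.sum_const, Finset.card_range, nsmul_eq_mul, Nat.cast_succ]

end Syndromes

section Existence

theorem four_le_card_of_balanced {Δ : Finset ℤ} {δ : ℤ → ℤ} (hne : Δ.Nonempty)
    (hδ : ∀ m ∈ Δ, δ m = 1 ∨ δ m = -1) (h0 : ∑ m ∈ Δ, δ m = 0) (h1 : ∑ m ∈ Δ, m * δ m = 0) :
    4 ≤ Δ.card := by
  by_contra! hcard
  have hpos := hne.card_pos
  obtain h | h | h : Δ.card = 1 ∨ Δ.card = 2 ∨ Δ.card = 3 := by omega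
  · obtain ⟨a, rfl⟩ := Finset.card_eq_one.1 h
    have := hδ a (by simp)
    rw [Finset.sum_singleton] at h0
    omega
  · obtain ⟨a, b, hab, rfl⟩ := Finset.card_eq_two.1 h
    rw [Finset.sum_pair hab] at h0 h1
    rw [eq_neg_of_add_eq_zero_right h0] at h1
    have hprod : (a - b) * δ a = 0 := by linarith
    rcases mul_eq_zero.1 hprod with h | h
    · exact hab (sub_eq_zero.1 h)
    · have := hδ a (by simp)
      omega
  · obtain ⟨a, b, c, hab, hac, hbc, rfl⟩ := Finset.card_eq_three.1 h
    have := hδ a (by simp)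
    have := hδ b (by simp)
    have := hδ c (by simp)
    rw [Finset.sum_insert (by simp [hab, hac]), Finset.sum_pair hbc] at h0
    omega

theorem exists_two_extreme_pairs {α : Type*} [LinearOrder α] {Δ : Finset α} (h : 4 ≤ Δ.card) :
    ∃ f ∈ Δ, ∃ f₂ ∈ Δ, ∃ l₂ ∈ Δ, ∃ l ∈ Δ, f < f₂ ∧ f₂ < l₂ ∧ l₂ < l ∧
      ∀ m ∈ Δ, f ≤ m ∧ m ≤ l ∧ (m = f ∨ f₂ ≤ m) ∧ (m = l ∨ m ≤ l₂) := by
  let e := Δ.orderEmbOfFin rfl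
  have he (i : Fin Δ.card) : e i ∈ Δ := Δ.orderEmbOfFin_mem rfl i
  refine ⟨e ⟨0, by omega⟩, he _, e ⟨1, by omega⟩, he _, e ⟨Δ.card - 2, by omega⟩, he _,
    e ⟨Δ.card - 1, by omega⟩, he _, ?_, ?_, ?_, fun m hm => ?_⟩
  · exact e.lt_iff_lt.2 (Fin.mk_lt_mk.2 (by omega))
  · exact e.lt_iff_lt.2 (Fin.mk_lt_mk.2 (by omega))
  · exact e.lt_iff_lt.2 (Fin.mk_lt_mk.2 (by omega))
  · obtain ⟨⟨i, hi⟩, rfl⟩ : m ∈ Set.range e := by rwa [Finset.range_orderEmbOfFin]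
    simp only [e.le_iff_le, e.injective.eq_iff, Fin.mk_le_mk, Fin.mk.injEq]
    omega

theorem exists_balancedPair {x y : ℤ → Bool} {n : ℤ} (hne : x ≠ y)
    (hout : ∀ m, m < 0 ∨ n ≤ m → x m = y m)
    (h0 : ∑ m ∈ Finset.Ico 0 n, (bit x m - bit y m) = 0)
    (h1 : ∑ m ∈ Finset.Ico 0 n, (m * bit x m - m * bit y m) = 0) :
    ∃ f f₂ l₂ l, BalancedPair x y f f₂ l₂ l ∧ 0 ≤ f ∧ l < n := by
  let Δ : Finset ℤ := {m ∈ Finset.Ico 0 n | x m ≠ y m}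
  have hsub : Δ ⊆ Finset.Ico 0 n := Finset.filter_subset _ _
  have hmem (m : ℤ) : m ∈ Δ ↔ x m ≠ y m := by
    refine ⟨fun hm => (Finset.mem_filter.1 hm).2, fun hm => Finset.mem_filter.2 ⟨?_, hm⟩⟩
    have := mt (hout m) hm
    rw [Finset.mem_Ico]
    omega
  have heq (m : ℤ) (hm : m ∉ Δ) : x m = y m := not_ne_iff.1 (mt (hmem m).2 hm)
  have hsum0 {s : Finset ℤ} (hs : Δ ⊆ s) :
      ∑ m ∈ Δ, (bit x m - bit y m) = ∑ m ∈ s, (bit x m - bit y m) :=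
    Finset.sum_subset hs fun m _ hm => bit_sub_eq_zero (heq m hm)
  have hsum1 {s : Finset ℤ} (hs : Δ ⊆ s) :
      ∑ m ∈ Δ, (m * bit x m - m * bit y m) = ∑ m ∈ s, (m * bit x m - m * bit y m) :=
    Finset.sum_subset hs fun m _ hm => by rw [bit_eq_bit_iff.2 (heq m hm), sub_self]
  have hcard : 4 ≤ Δ.card := by
    obtain ⟨m, hm⟩ := Function.ne_iff.1 hne
    refine four_le_card_of_balanced (δ := fun m => bit x m - bit y m) ⟨m, (hmem m).2 hm⟩
      (fun m hm => bit_sub_of_ne ((hmem m).1 hm)) ((hsum0 hsub).trans h0) ?_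
    simpa only [mul_sub] using (hsum1 hsub).trans h1
  obtain ⟨f, hf, f₂, hf₂, l₂, hl₂, l, hl, hff₂, hfl₂, hl₂l, hext⟩ := exists_two_extreme_pairs hcard
  have hIcc : Δ ⊆ Finset.Icc f l := fun m hm =>
    Finset.mem_Icc.2 ⟨(hext m hm).1, (hext m hm).2.1⟩
  exact ⟨f, f₂, l₂, l, {
    lt_first := hff₂
    lt_mid := hfl₂
    lt_last := hl₂l
    ne_f := (hmem f).1 hf
    ne_f₂ := (hmem f₂).1 hf₂
    ne_l₂ := (hmem l₂).1 hl₂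
    ne_l := (hmem l).1 hl
    before := fun m hm => heq m fun h => by have := hext m h; omega
    gap_first := fun m hm hm' => heq m fun h => by have := hext m h; omega
    gap_last := fun m hm hm' => heq m fun h => by have := hext m h; omega
    after := fun m hm => heq m fun h => by have := hext m h; omega
    sum_zero := (hsum0 hIcc).symm.trans ((hsum0 hsub).trans h0)
    sum_one := (hsum1 hIcc).symm.trans ((hsum1 hsub).trans h1) },
    (Finset.mem_Ico.1 (hsub hf)).1, (Finset.mem_Ico.1 (hsub hl)).2⟩

theorem exists_hasPeriod_le {p : ℕ} {w : List Bool} (hp : 0 < p) (h : ShiftInvariant p w) :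
    ∃ q ≤ p, HasPeriod q w :=
  ⟨sInf {q | 0 < q ∧ ShiftInvariant q w}, Nat.sInf_le ⟨hp, h⟩, Nat.sInf_mem ⟨p, hp, h⟩,
    fun _ hq => Nat.sInf_le hq⟩

theorem aperiodic_pad {n t : ℕ} {x : List Bool} {f l : ℤ} (hx : x ∈ periodBounded n 2 t)
    (hf : 0 ≤ f) (hl : l < n) : Aperiodic t (pad x) f l := by
  obtain ⟨hlen : x.length = n, hper⟩ := hx
  intro a hfa hal
  by_contra! hcon
  lift a to ℕ using by omega
  let w := (x.drop a).take (t + 1)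
  have hw : w <:+: x := (List.take_prefix _ _).isInfix.trans (List.drop_suffix _ _).isInfix
  have hwlen : w.length = t + 1 := by
    rw [List.length_take, List.length_drop]
    omega
  have hget (k : ℕ) (hk : k < t + 1) : w[k]? = some (pad x (a + k)) := by
    rw [← Nat.cast_add, pad_natCast, List.getD_eq_getElem _ _ (by omega),
      List.getElem?_take_of_lt hk, List.getElem?_drop, List.getElem?_eq_getElem (by omega)]
  have hshift : ShiftInvariant 2 w := fun k hk => by
    rw [hget k (by omega), hget (k + 2) (by omega), hcon _ (by omega) (by omega), Nat.cast_add,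
      Nat.cast_two, add_assoc]
  have := hper w hw (exists_hasPeriod_le two_pos hshift)
  omega

end Existence

section Blocks

variable {x y : List Bool} {P n s M : ℕ}

theorem drop_take_eq_drop_take (hlen : x.length = y.length)
    (h : ∀ k : ℤ, s ≤ k → k < s + M → pad x k = pad y k) :
    (x.drop s).take M = (y.drop s).take M := by
  refine eq_of_pad_eq (by simp only [List.length_take, List.length_drop, hlen]) (funext fun c => ?_)
  rcases lt_or_ge c 0 with hc | hc
  · rw [pad_of_neg _ hc, pad_of_neg _ hc]
  rcases lt_or_ge c M with hcM | hcM
  · rw [pad_drop_take x s M hc hcM, pad_drop_take y s M hc hcM, h _ (by omega) (by omega)]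
  · have hle (w : List Bool) : (((w.drop s).take M).length : ℤ) ≤ c :=
      (Int.ofNat_le.2 (List.length_take_le _ _)).trans hcM
    rw [pad_of_length_le _ (hle x), pad_of_length_le _ (hle y)]

/-- Two consecutive blocks of length `P`, starting after the first `b` blocks. The windows with
even and with odd `b` are the blocks of the two block sums, and every interval of length at most
`P` lies in one of the windows. -/
def window (P : ℕ) (x : List Bool) (b : ℕ) : List Bool := (x.drop (b * P)).take (2 * P)

theorem block_append_block (P : ℕ) (x : List Bool) (b : ℕ) :
    block P x (b + 1) ++ block P x (b + 1 + 1) = window P x b := by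
  rw [block, block, window, Nat.add_sub_cancel, Nat.add_sub_cancel, two_mul, List.take_add,
    List.drop_drop, add_mul, one_mul]

theorem sum_Icc_one_eq_sum_range (F : ℕ → ℕ) (m : ℕ) :
    ∑ i ∈ Finset.Icc 1 m, F i = ∑ c ∈ Finset.range m, F (c + 1) := by
  rw [Finset.range_eq_Ico, Finset.sum_Ico_add', zero_add]
  rfl

theorem oddBlockSum_eq (P k : ℕ) (x : List Bool) :
    oddBlockSum P k x = ∑ c ∈ Finset.range (x.length / P + 1), vt k (window P x (2 * c + 0)) := by
  rw [oddBlockSum, sum_Icc_one_eq_sum_range]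
  exact Finset.sum_congr rfl fun c _ => by rw [← block_append_block]; rfl

theorem evenBlockSum_eq (P k : ℕ) (x : List Bool) :
    evenBlockSum P k x = ∑ c ∈ Finset.range (x.length / P + 1), vt k (window P x (2 * c + 1)) := by
  rw [evenBlockSum, sum_Icc_one_eq_sum_range]
  exact Finset.sum_congr rfl fun c _ => by rw [← block_append_block]; rfl

theorem modEq_of_sum_modEq {ι : Type*} {s : Finset ι} {F G : ι → ℕ} {i₀ : ι} (hi₀ : i₀ ∈ s)
    (heq : ∀ i ∈ s, i ≠ i₀ → F i = G i) (h : ∑ i ∈ s, F i ≡ ∑ i ∈ s, G i [MOD M]) :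
    F i₀ ≡ G i₀ [MOD M] := by
  classical
  rw [← Finset.add_sum_erase _ _ hi₀, ← Finset.add_sum_erase _ _ hi₀,
    Finset.sum_congr rfl fun i hi => heq i (Finset.mem_of_mem_erase hi)
      (Finset.ne_of_mem_erase hi)] at h
  exact Nat.ModEq.add_right_cancel' _ h

theorem vt_window_modEq {B c ε m k : ℕ}
    (hwin : ∀ b, b + 2 ≤ B ∨ B + 2 ≤ b → window P x b = window P y b) (hB : B = 2 * c + ε)
    (hc : c < m) (h : ∑ c ∈ Finset.range m, vt k (window P x (2 * c + ε)) ≡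
      ∑ c ∈ Finset.range m, vt k (window P y (2 * c + ε)) [MOD M]) :
    vt k (window P x B) ≡ vt k (window P y B) [MOD M] := by
  subst hB
  exact modEq_of_sum_modEq (F := fun c => vt k (window P x (2 * c + ε)))
    (G := fun c => vt k (window P y (2 * c + ε))) (Finset.mem_range.2 hc)
    (fun d _ hd => congrArg (vt k) (hwin _ (by omega))) h

theorem vt_window_modEq_of_mem_codeBlocks {g g' : Fin 3 → ℕ} {B : ℕ} (hx : x ∈ codeBlocks n P g g')
    (hy : y ∈ codeBlocks n P g g') (hB : B ≤ n / P)
    (hwin : ∀ b, b + 2 ≤ B ∨ B + 2 ≤ b → window P x b = window P y b) (k : Fin 3) :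
    vt (k + 1) (window P x B) ≡ vt (k + 1) (window P y B) [MOD 3 * (2 * P) ^ ((k : ℕ) + 1)] := by
  obtain ⟨hxl : x.length = n, hx⟩ := hx
  obtain ⟨hyl : y.length = n, hy⟩ := hy
  have hodd := (hx k).1.trans (hy k).1.symm
  have heven := (hx k).2.trans (hy k).2.symm
  rw [oddBlockSum_eq, oddBlockSum_eq, hxl, hyl] at hodd
  rw [evenBlockSum_eq, evenBlockSum_eq, hxl, hyl] at heven
  obtain ⟨c, hc | hc⟩ := Nat.even_or_odd' B
  · exact vt_window_modEq hwin hc (by omega) hodd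
  · exact vt_window_modEq hwin hc (by omega) heven

theorem eq_zero_of_modEq_of_abs_lt {a b : ℕ} {D : ℤ} (h : a ≡ b [MOD M]) (hD : (a : ℤ) - b = D)
    (hlt : |D| < M) : D = 0 :=
  Int.eq_zero_of_abs_lt_dvd (hD ▸ h.symm.dvd) hlt

namespace BalancedPair

variable {f f₂ l₂ l : ℤ}

theorem not_vt_drop_take_modEq (C : BalancedPair (pad x) (pad y) f f₂ l₂ l) {r : ℤ} (hlr : l < r)
    (hS : FewSignChanges (suffixDiff (pad x) (pad y) r)) (hsf : s ≤ f) (hls : l < s + M)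
    (hmod : ∀ k < 3, vt (k + 1) ((x.drop s).take M) ≡ vt (k + 1) ((y.drop s).take M)
      [MOD 3 * M ^ (k + 1)]) : False := by
  have := C.lt_first
  have := C.lt_mid
  have := C.lt_last
  have hafter {n₁ : ℤ} (hn₁ : l < n₁) (k : ℤ) (hk : n₁ ≤ k) : pad x k = pad y k :=
    C.after k (hn₁.trans_le hk)
  have hzero := hS.eq_zero (s₀ := s) (N := M) fun k hk => by
    have hM : 0 < (M : ℤ) ^ (k + 1) := pow_pos (by omega) _
    refine eq_zero_of_modEq_of_abs_lt (hmod k hk) ?_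
      ((hS.abs_moment_le s M k).trans_lt (by push_cast; linarith))
    simp only [vt_drop_take_sub, suffixDiff_eq_of_eq_right (hafter hls) (hafter hlr)]
  obtain ⟨a, ha⟩ := Int.eq_ofNat_of_zero_le (sub_nonneg.2 hsf)
  have hf : suffixDiff (pad x) (pad y) r f = 0 := by
    rw [← hzero a (by omega)]
    congr 1
    omega
  have hf' : suffixDiff (pad x) (pad y) r (f + 1) = 0 := by
    rw [← hzero (a + 1) (by omega)]
    congr 1
    omega
  rw [suffixDiff_eq_add _ _ (by omega), hf', add_zero] at hf
  exact C.ne_f (bit_eq_bit_iff.1 (sub_eq_zero.1 hf))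

theorem lt_sub_of_mem_codeBlocks (C : BalancedPair (pad x) (pad y) f f₂ l₂ l) (hP : 0 < P)
    (hf : 0 ≤ f) (hln : l < n) (hS : FewSignChanges (suffixDiff (pad x) (pad y) n))
    {g g' : Fin 3 → ℕ} (hx : x ∈ codeBlocks n P g g') (hy : y ∈ codeBlocks n P g g') :
    P < l - f := by
  have := C.lt_first
  have := C.lt_mid
  have := C.lt_last
  by_contra! hlf
  lift f to ℕ using hf
  lift l to ℕ using by omega
  have hBf : f / P * P ≤ f := Nat.div_mul_le_self f P
  have hfB : f < f / P * P + P := Nat.lt_div_mul_add hP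
  have hl : l < f / P * P + 2 * P := by omega
  have hwin : ∀ b, b + 2 ≤ f / P ∨ f / P + 2 ≤ b → window P x b = window P y b := by
    refine fun b hb => drop_take_eq_drop_take (hx.1.trans hy.1.symm) fun m hm hm' => ?_
    rcases hb with hb | hb
    all_goals
      have hle := Nat.mul_le_mul_right P hb
      rw [add_mul] at hle
    · exact C.before m (by omega)
    · exact C.after m (by omega)
  exact C.not_vt_drop_take_modEq hln hS (s := f / P * P) (M := 2 * P) (by exact_mod_cast hBf)
    (by exact_mod_cast hl) fun k hk =>
      vt_window_modEq_of_mem_codeBlocks hx hy (Nat.div_le_div_right (by omega)) hwin ⟨k, hk⟩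

end BalancedPair

end Blocks

section Reconstruction

variable {x y z : List Bool} {n t P s₀ s₁ : ℕ}

theorem pad_eq_pad_of_outside (hx : x.length = n) (hy : y.length = n) {m : ℤ}
    (hm : m < 0 ∨ n ≤ m) : pad x m = pad y m := by
  rcases hm with hm | hm
  · rw [pad_of_neg x hm, pad_of_neg y hm]
  · rw [pad_of_length_le x (hx ▸ hm), pad_of_length_le y (hy ▸ hm)]

theorem suffixDiff_zero_of_mem_codeVT (hx : x ∈ codeVT n s₀ s₁) (hy : y ∈ codeVT n s₀ s₁)
    (hzx : z ∈ dsBall x) (hzy : z ∈ dsBall y) : suffixDiff (pad x) (pad y) n 0 = 0 := by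
  obtain ⟨hxl : x.length = n, hx0, -⟩ := hx
  obtain ⟨hyl : y.length = n, hy0, -⟩ := hy
  obtain ⟨i, hi, hui⟩ := exists_hammingLE_of_mem_dsBall hzx
  obtain ⟨j, hj, huj⟩ := exists_hammingLE_of_mem_dsBall hzy
  exact eq_zero_of_modEq_of_abs_lt (hx0.trans hy0.symm) (vt_zero_sub hxl hyl)
    ((abs_suffixDiff_le_three (hxl ▸ hi) (hyl ▸ hj) hui huj 0).trans_lt (by norm_num))

theorem fewSignChanges_of_mem_codeVT (hx : x ∈ codeVT n s₀ s₁) (hy : y ∈ codeVT n s₀ s₁)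
    (hzx : z ∈ dsBall x) (hzy : z ∈ dsBall y) :
    FewSignChanges (suffixDiff (pad x) (pad y) n) := by
  have hS := suffixDiff_zero_of_mem_codeVT hx hy hzx hzy
  obtain ⟨hxl : x.length = n, -⟩ := hx
  obtain ⟨hyl : y.length = n, -⟩ := hy
  obtain ⟨i, hi, hui⟩ := exists_hammingLE_of_mem_dsBall hzx
  obtain ⟨j, hj, huj⟩ := exists_hammingLE_of_mem_dsBall hzy
  refine fewSignChanges_suffixDiff (hxl ▸ hi) (hyl ▸ hj) hui huj (r := 0) fun m hm => ?_
  rw [← hS]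
  exact suffixDiff_eq_of_eq_left hm (fun k hk => pad_eq_pad_of_outside hxl hyl (Or.inl hk)) n

theorem FewSignChanges.abs_sum_range_lt {S : ℤ → ℤ} (hS : FewSignChanges S) (h0 : S 0 = 0)
    (hn : 0 < n) : |∑ r ∈ Finset.range n, S r| < 2 * n := by
  obtain ⟨k, rfl⟩ := Nat.exists_eq_add_of_lt hn
  have hmoment := hS.abs_moment_le 1 k 0
  simp only [pow_zero, one_mul, zero_add, pow_one] at hmoment ⊢
  rw [Finset.sum_range_succ', Nat.cast_zero, h0, add_zero]
  simp only [Nat.cast_succ, add_comm _ (1 : ℤ)]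
  linarith

theorem vt_one_eq_of_mem_codeVT (hx : x ∈ codeVT n s₀ s₁) (hy : y ∈ codeVT n s₀ s₁)
    (hzx : z ∈ dsBall x) (hzy : z ∈ dsBall y) : vt 1 x = vt 1 y := by
  have hS0 := suffixDiff_zero_of_mem_codeVT hx hy hzx hzy
  have hS := fewSignChanges_of_mem_codeVT hx hy hzx hzy
  obtain ⟨hxl : x.length = n, -, hx1⟩ := hx
  obtain ⟨hyl : y.length = n, -, hy1⟩ := hy
  have hn : 0 < n := by
    rw [← hxl, ← length_of_mem_dsBall hzx]
    exact Nat.succ_pos _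
  have hsum := eq_zero_of_modEq_of_abs_lt (hx1.trans hy1.symm) (vt_one_sub hxl hyl)
    (by exact_mod_cast hS.abs_sum_range_lt hS0 hn)
  rw [← vt_one_sub hxl hyl, sub_eq_zero] at hsum
  exact_mod_cast hsum

theorem exists_balancedPair_of_mem_codeVT (hne : x ≠ y) (hx : x ∈ codeVT n s₀ s₁)
    (hy : y ∈ codeVT n s₀ s₁) (hzx : z ∈ dsBall x) (hzy : z ∈ dsBall y) :
    ∃ f f₂ l₂ l : ℤ, BalancedPair (pad x) (pad y) f f₂ l₂ l ∧ 0 ≤ f ∧ l < n := by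
  have h0 := suffixDiff_zero_of_mem_codeVT hx hy hzx hzy
  have h1 := congrArg (Nat.cast (R := ℤ)) (vt_one_eq_of_mem_codeVT hx hy hzx hzy)
  obtain ⟨hxl : x.length = n, -⟩ := hx
  obtain ⟨hyl : y.length = n, -⟩ := hy
  rw [suffixDiff] at h0
  rw [vt_one_eq hxl, vt_one_eq hyl] at h1
  refine exists_balancedPair (fun h => hne (eq_of_pad_eq (hxl.trans hyl.symm) h))
    (fun m => pad_eq_pad_of_outside hxl hyl) h0 ?_
  simp only [add_mul, one_mul, Finset.sum_add_distrib, Finset.sum_sub_distrib] at h0 h1 ⊢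
  linarith

theorem isReconstructionCode_inter (ht : 0 < t) (hP : 6 * t ≤ P) (g g' : Fin 3 → ℕ) :
    IsReconstructionCode n 11 (periodBounded n 2 t ∩ codeVT n s₀ s₁ ∩ codeBlocks n P g g') := by
  refine ⟨fun x hx => hx.1.1.1, fun x ⟨⟨hxR, hxV⟩, hxB⟩ y ⟨⟨hyR, hyV⟩, hyB⟩ hne => ?_⟩
  rcases (dsBall x ∩ dsBall y).eq_empty_or_nonempty with hempty | ⟨z, hzx, hzy⟩
  · rw [hempty, Set.encard_empty]
    norm_num
  obtain ⟨f, f₂, l₂, l, C, hf, hl⟩ := exists_balancedPair_of_mem_codeVT hne hxV hyV hzx hzy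
  have hlong : P < l - f :=
    C.lt_sub_of_mem_codeBlocks (by omega) hf hl (fewSignChanges_of_mem_codeVT hxV hyV hzx hzy)
      hxB hyB
  calc (dsBall x ∩ dsBall y).encard
      ≤ (forwardSet (pad x) (pad y) ∪ forwardSet (pad y) (pad x)).encard :=
        encard_dsBall_inter_le x y
    _ ≤ 10 := C.encard_forwardSet_union_le (t := t) (by exact_mod_cast ht)
        (aperiodic_pad hxR hf hl) (aperiodic_pad hyR hf hl) (by omega)
    _ < (11 : ℕ) := by norm_num

theorem isReconstructionCode_code11 (n s₀ s₁ : ℕ) (g g' : Fin 3 → ℕ) :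
    IsReconstructionCode n 11 (code11 n s₀ s₁ g g') :=
  isReconstructionCode_inter (Nat.succ_pos _) (Nat.le_add_right _ 4) g g'

end Reconstruction

section PeriodBounded

variable {n p t L a : ℕ} {u v w : List Bool}

theorem finite_words (n : ℕ) : (Words n).Finite := List.finite_length_eq Bool n

theorem finite_periodBounded (n p t : ℕ) : (periodBounded n p t).Finite :=
  (finite_words n).subset fun _ hx => hx.1

theorem ncard_words (n : ℕ) : (Words n).ncard = 2 ^ n := by
  have hcard : Nat.card (List.Vector Bool n) = 2 ^ n := by
    rw [Nat.card_eq_fintype_card, card_vector, Fintype.card_bool]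
  rwa [← Nat.card_coe_set_eq]

theorem ShiftInvariant.eq_of_take_eq (hu : ShiftInvariant p u) (hv : ShiftInvariant p v)
    (hp : 0 < p) (hlen : u.length = v.length) (h : u.take p = v.take p) : u = v := by
  refine List.ext_getElem? fun k => ?_
  induction k using Nat.strong_induction_on with
  | _ k ih =>
    rcases lt_or_ge k p with hkp | hkp
    · rw [← List.getElem?_take_of_lt hkp, h, List.getElem?_take_of_lt hkp]
    obtain ⟨j, rfl⟩ := Nat.exists_eq_add_of_le' hkp
    rcases lt_or_ge (j + p) u.length with hk | hk
    · rw [← hu j hk, ← hv j (hlen ▸ hk), ih j (by omega)]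
    · rw [List.getElem?_eq_none hk, List.getElem?_eq_none (hlen ▸ hk)]

theorem ShiftInvariant.take (h : ShiftInvariant p w) (L : ℕ) : ShiftInvariant p (w.take L) := by
  intro i hi
  rw [List.length_take, lt_min_iff] at hi
  rw [List.getElem?_take_of_lt (by omega), List.getElem?_take_of_lt hi.1, h i hi.2]

theorem ShiftInvariant.two_mul (h : ShiftInvariant p w) : ShiftInvariant (2 * p) w := by
  intro i hi
  rw [h i (by omega), h (i + p) (by omega), add_assoc, ← Nat.two_mul]

/-- The words of length `n` whose window of length `L` after the first `a` symbols is invariant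
under the shift by `p`. These are the events of the union bound for the words outside
`periodBounded n 2 t`; for them `p = 2` is enough, as a shift by `1` can be iterated. -/
def shiftInvariantAt (n p L a : ℕ) : Set (List Bool) :=
  {x | x ∈ Words n ∧ ShiftInvariant p ((x.drop a).take L)}

theorem injOn_take_append_drop (hp : 0 < p) (hpL : p ≤ L) :
    Set.InjOn (fun x => x.take (a + p) ++ x.drop (a + L)) (shiftInvariantAt n p L a) := by
  rintro x ⟨hx : x.length = n, hxp⟩ y ⟨hy : y.length = n, hyp⟩ hxy
  obtain ⟨htake, hdrop⟩ := List.append_inj hxy (by simp only [List.length_take, hx, hy])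
  rw [List.take_add, List.take_add] at htake
  obtain ⟨hprefix, hstart⟩ := List.append_inj htake (by simp only [List.length_take, hx, hy])
  have hwindow : (x.drop a).take L = (y.drop a).take L :=
    hxp.eq_of_take_eq hyp hp (by simp only [List.length_take, List.length_drop, hx, hy])
      (by rwa [List.take_take, List.take_take, min_eq_left hpL])
  rw [← List.take_append_drop (a + L) x, ← List.take_append_drop (a + L) y, List.take_add,
    List.take_add, hprefix, hwindow, hdrop]

theorem ncard_shiftInvariantAt_le (hp : 0 < p) (hpL : p ≤ L) (h : a + L ≤ n) :
    (shiftInvariantAt n p L a).ncard ≤ 2 ^ (n - L + p) := by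
  rw [← ncard_words]
  refine Set.ncard_le_ncard_of_injOn _ ?_ (injOn_take_append_drop hp hpL) (finite_words _)
  rintro x ⟨hx : x.length = n, -⟩
  simp only [Words, Set.mem_ofPred_eq, List.length_append, List.length_take, List.length_drop]
  omega

theorem words_subset_periodBounded_union (n t : ℕ) :
    Words n ⊆ periodBounded n 2 t ∪
      ⋃ a ∈ Finset.range (n - t), shiftInvariantAt n 2 (t + 1) a := by
  intro x hx
  refine or_iff_not_imp_left.2 fun hnot => ?_
  have hexists : ¬∀ w : List Bool, w <:+: x → (∃ p ≤ 2, HasPeriod p w) → w.length ≤ t :=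
    fun h => hnot ⟨hx, h⟩
  push Not at hexists
  obtain ⟨w, ⟨u, v, rfl⟩, ⟨p, hp2, ⟨hp0, hp⟩, -⟩, hlt⟩ := hexists
  have hw : ShiftInvariant 2 w := by
    obtain rfl | rfl : p = 1 ∨ p = 2 := by omega
    · exact hp.two_mul
    · exact hp
  have hlen : (u ++ w ++ v).length = n := hx
  rw [List.length_append, List.length_append] at hlen
  refine Set.mem_biUnion (x := u.length) (Finset.mem_coe.2 (Finset.mem_range.2 (by omega)))
    ⟨hx, ?_⟩
  rw [List.append_assoc, List.drop_left, List.take_append_of_le_length hlt]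
  exact hw.take _

theorem two_mul_ncard_biUnion_shiftInvariantAt_le (ht : 4 * n ≤ 2 ^ t) :
    2 * (⋃ a ∈ Finset.range (n - t), shiftInvariantAt n 2 (t + 1) a).ncard ≤ 2 ^ n := by
  rcases le_or_gt n t with hnt | hnt
  · simp [Nat.sub_eq_zero_of_le hnt]
  have ht0 : t ≠ 0 := by
    rintro rfl
    omega
  have hsum : (⋃ a ∈ Finset.range (n - t), shiftInvariantAt n 2 (t + 1) a).ncard ≤
      (n - t) * 2 ^ (n - (t + 1) + 2) := by
    refine (Finset.set_ncard_biUnion_le _ _).trans ((Finset.sum_le_card_nsmul _ _ _ fun a ha =>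
      ncard_shiftInvariantAt_le two_pos (by omega) ?_).trans_eq ?_)
    · rw [Finset.mem_range] at ha
      omega
    · rw [Finset.card_range, smul_eq_mul]
  calc 2 * (⋃ a ∈ Finset.range (n - t), shiftInvariantAt n 2 (t + 1) a).ncard
      ≤ 2 * ((n - t) * 2 ^ (n - (t + 1) + 2)) := Nat.mul_le_mul_left 2 hsum
    _ = 4 * (n - t) * 2 ^ (n - t) := by
        rw [show n - (t + 1) + 2 = n - t + 1 by omega, pow_succ]
        ring
    _ ≤ 2 ^ t * 2 ^ (n - t) := Nat.mul_le_mul_right _ (by omega)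
    _ = 2 ^ n := by rw [← pow_add, Nat.add_sub_cancel' hnt.le]

theorem two_pow_le_two_mul_ncard_periodBounded (ht : 4 * n ≤ 2 ^ t) :
    2 ^ n ≤ 2 * (periodBounded n 2 t).ncard := by
  have hcover := Set.ncard_le_ncard (words_subset_periodBounded_union n t)
    ((finite_periodBounded n 2 t).union ((Finset.finite_toSet _).biUnion fun a _ =>
      (finite_words n).subset fun _ hx => hx.1))
  have hunion := Set.ncard_union_le (periodBounded n 2 t)
    (⋃ a ∈ Finset.range (n - t), shiftInvariantAt n 2 (t + 1) a)
  have hsmall := two_mul_ncard_biUnion_shiftInvariantAt_le ht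
  rw [ncard_words] at hcover
  omega

theorem four_mul_le_two_pow_tParam (n : ℕ) : 4 * n ≤ 2 ^ tParam n := by
  rcases n.eq_zero_or_pos with rfl | hn
  · exact Nat.zero_le _
  have hceil : n ≤ 2 ^ ⌈Real.logb 2 (n : ℝ)⌉₊ := by
    have hreal := (Real.logb_le_iff_le_rpow one_lt_two (Nat.cast_pos.2 hn)).1
      (Nat.le_ceil (Real.logb 2 (n : ℝ)))
    rw [Real.rpow_natCast] at hreal
    exact_mod_cast hreal
  rw [tParam, pow_add]
  omega

end PeriodBounded

section Redundancy

variable {n P s₀ s₁ : ℕ} {g g' : Fin 3 → ℕ}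

/-- The residues that decide in which of the codes `codeVT n s₀ s₁ ∩ codeBlocks n P g g'` a word
lies, as a tuple `(s₀, s₁, g, g')`. -/
def syndrome (n P : ℕ) (x : List Bool) : ℕ × ℕ × (Fin 3 → ℕ) × (Fin 3 → ℕ) :=
  (vt 0 x % 4, vt 1 x % (2 * n),
    fun k => oddBlockSum P (k + 1) x % (3 * (2 * P) ^ ((k : ℕ) + 1)),
    fun k => evenBlockSum P (k + 1) x % (3 * (2 * P) ^ ((k : ℕ) + 1)))

/-- The box of all possible values `(s₀, s₁, g, g')` of `syndrome n P`. -/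
def syndromeBox (n P : ℕ) : Finset (ℕ × ℕ × (Fin 3 → ℕ) × (Fin 3 → ℕ)) :=
  Finset.range 4 ×ˢ Finset.range (2 * n) ×ˢ
    (Fintype.piFinset fun k : Fin 3 => Finset.range (3 * (2 * P) ^ ((k : ℕ) + 1))) ×ˢ
    (Fintype.piFinset fun k : Fin 3 => Finset.range (3 * (2 * P) ^ ((k : ℕ) + 1)))

theorem mem_syndromeBox : (s₀, s₁, g, g') ∈ syndromeBox n P ↔
    s₀ < 4 ∧ s₁ < 2 * n ∧ (∀ k : Fin 3, g k < 3 * (2 * P) ^ ((k : ℕ) + 1)) ∧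
      ∀ k : Fin 3, g' k < 3 * (2 * P) ^ ((k : ℕ) + 1) := by
  simp only [syndromeBox, Finset.mem_product, Finset.mem_range, Fintype.mem_piFinset]

theorem validParams_of_mem_syndromeBox (h : (s₀, s₁, g, g') ∈ syndromeBox n (pParam n)) :
    ValidParams n s₀ s₁ g g' := by
  obtain ⟨h₀, h₁, hg, hg'⟩ := mem_syndromeBox.1 h
  exact ⟨h₀, h₁, fun k => ⟨hg k, hg' k⟩⟩

theorem syndrome_mem_syndromeBox (hn : 0 < n) (hP : 0 < P) (x : List Bool) :
    syndrome n P x ∈ syndromeBox n P :=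
  mem_syndromeBox.2 ⟨Nat.mod_lt _ (by norm_num), Nat.mod_lt _ (by omega),
    fun _ => Nat.mod_lt _ (by positivity), fun _ => Nat.mod_lt _ (by positivity)⟩

theorem card_syndromeBox (n P : ℕ) : (syndromeBox n P).card = 5832 * n * (2 * P) ^ 12 := by
  simp only [syndromeBox, Finset.card_product, Finset.card_range, Fintype.card_piFinset,
    Fin.prod_univ_three, Fin.val_zero, Fin.val_one, Fin.val_two]
  ring

theorem mem_code_of_syndrome_eq {x : List Bool} (hx : x ∈ Words n)
    (h : syndrome n P x = (s₀, s₁, g, g')) : x ∈ codeVT n s₀ s₁ ∩ codeBlocks n P g g' := by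
  simp only [syndrome, Prod.mk.injEq] at h
  obtain ⟨rfl, rfl, rfl, rfl⟩ := h
  exact ⟨⟨hx, (Nat.mod_modEq _ _).symm, (Nat.mod_modEq _ _).symm⟩, hx,
    fun _ => ⟨(Nat.mod_modEq _ _).symm, (Nat.mod_modEq _ _).symm⟩⟩

theorem exists_ncard_le_card_mul_ncard_code (hn : 0 < n) (hP : 0 < P) {A : Set (List Bool)}
    (hA : A ⊆ Words n) : ∃ s₀ s₁ g g', (s₀, s₁, g, g') ∈ syndromeBox n P ∧
      A.ncard ≤ 5832 * n * (2 * P) ^ 12 * (A ∩ codeVT n s₀ s₁ ∩ codeBlocks n P g g').ncard := by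
  classical
  have hfin : A.Finite := (finite_words n).subset hA
  let fiber (σ : ℕ × ℕ × (Fin 3 → ℕ) × (Fin 3 → ℕ)) : Finset (List Bool) :=
    {x ∈ hfin.toFinset | syndrome n P x = σ}
  obtain ⟨⟨s₀, s₁, g, g'⟩, hmem, hmax⟩ := Finset.exists_max_image (syndromeBox n P)
    (fun σ => (fiber σ).card) ⟨_, syndrome_mem_syndromeBox hn hP []⟩
  have hfiber : ((fiber (s₀, s₁, g, g') : Finset _) : Set (List Bool)) ⊆
      A ∩ codeVT n s₀ s₁ ∩ codeBlocks n P g g' := fun x hx => by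
    obtain ⟨hxA, hxσ⟩ := Finset.mem_filter.1 hx
    rw [Set.Finite.mem_toFinset] at hxA
    rw [Set.inter_assoc]
    exact ⟨hxA, mem_code_of_syndrome_eq (hA hxA) hxσ⟩
  refine ⟨s₀, s₁, g, g', hmem, ?_⟩
  calc A.ncard = hfin.toFinset.card := Set.ncard_eq_toFinset_card A hfin
    _ ≤ (fiber (s₀, s₁, g, g')).card * (syndromeBox n P).card :=
        Finset.card_le_mul_card_image_of_maps_to
          (fun x _ => syndrome_mem_syndromeBox hn hP x) _ hmax
    _ ≤ _ := by
        rw [card_syndromeBox, mul_comm, ← Set.ncard_coe_finset]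
        exact Nat.mul_le_mul_left _ (Set.ncard_le_ncard hfiber
          (hfin.subset fun _ hx => hx.1.1))

theorem exists_two_pow_le_mul_ncard_code11 (hn : 0 < n) : ∃ s₀ s₁ g g',
    ValidParams n s₀ s₁ g g' ∧
      2 ^ n ≤ 2 * (5832 * n * (2 * pParam n) ^ 12) * (code11 n s₀ s₁ g g').ncard := by
  obtain ⟨s₀, s₁, g, g', hmem, hle⟩ := exists_ncard_le_card_mul_ncard_code hn
    (Nat.succ_pos _ : 0 < pParam n) (A := periodBounded n 2 (tParam n)) fun _ hx => hx.1
  refine ⟨s₀, s₁, g, g', validParams_of_mem_syndromeBox hmem, ?_⟩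
  rw [mul_assoc 2]
  exact (two_pow_le_two_mul_ncard_periodBounded (four_mul_le_two_pow_tParam n)).trans
    (Nat.mul_le_mul_left 2 hle)

theorem nonempty_of_two_pow_le {C : Set (List Bool)} {M : ℝ}
    (h : (2 : ℝ) ^ n ≤ M * C.ncard) : C.Nonempty := by
  by_contra hC
  rw [Set.not_nonempty_iff_eq_empty] at hC
  rw [hC, Set.ncard_empty, Nat.cast_zero, mul_zero] at h
  exact h.not_gt (by positivity)

theorem redundancy_le_logb {C : Set (List Bool)} {M : ℝ} (h : (2 : ℝ) ^ n ≤ M * C.ncard) :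
    redundancy n C ≤ Real.logb 2 M := by
  have hprod : 0 < M * C.ncard := lt_of_lt_of_le (by positivity) h
  have hlog := Real.logb_le_logb_of_le one_lt_two (by positivity) h
  rw [Real.logb_pow, Real.logb_self_eq_one one_lt_two, mul_one,
    Real.logb_mul (left_ne_zero_of_mul hprod.ne') (right_ne_zero_of_mul hprod.ne')] at hlog
  rw [redundancy]
  linarith

theorem one_le_logb_two (hn : 2 ≤ n) : 1 ≤ Real.logb 2 (n : ℝ) := by
  rw [Real.le_logb_iff_rpow_le one_lt_two (by positivity), Real.rpow_one]
  exact_mod_cast hn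

theorem two_mul_pParam_le (hn : 2 ≤ n) : (2 * pParam n : ℝ) ≤ 128 * Real.logb 2 (n : ℝ) := by
  have hlog := one_le_logb_two hn
  have hceil := Nat.ceil_lt_add_one (zero_le_one.trans hlog)
  rw [pParam, tParam]
  push_cast
  linarith

theorem exists_code11_redundancy_le (hn : 2 ≤ n) : ∃ s₀ s₁ g g',
    ValidParams n s₀ s₁ g g' ∧ (code11 n s₀ s₁ g g').Nonempty ∧
      redundancy n (code11 n s₀ s₁ g g') ≤
        Real.logb 2 (n : ℝ) + 12 * Real.logb 2 (Real.logb 2 (n : ℝ)) + 98 := by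
  obtain ⟨s₀, s₁, g, g', hvalid, hle⟩ := exists_two_pow_le_mul_ncard_code11 (by omega : 0 < n)
  have hlog : 0 < Real.logb 2 (n : ℝ) := zero_lt_one.trans_le (one_le_logb_two hn)
  have hcard : (2 : ℝ) ^ n ≤
      2 ^ 98 * n * Real.logb 2 (n : ℝ) ^ 12 * (code11 n s₀ s₁ g g').ncard := by
    calc (2 : ℝ) ^ n
        ≤ 2 * (5832 * n * (2 * pParam n) ^ 12) * (code11 n s₀ s₁ g g').ncard := by
          exact_mod_cast hle
      _ ≤ 2 * (8192 * n * (128 * Real.logb 2 (n : ℝ)) ^ 12) * (code11 n s₀ s₁ g g').ncard := by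
          gcongr 2 * (?_ * n * ?_ ^ 12) * _
          · norm_num
          · exact two_mul_pParam_le hn
      _ = 2 ^ 98 * n * Real.logb 2 (n : ℝ) ^ 12 * (code11 n s₀ s₁ g g').ncard := by ring
  refine ⟨s₀, s₁, g, g', hvalid, nonempty_of_two_pow_le hcard, ?_⟩
  calc redundancy n (code11 n s₀ s₁ g g')
      ≤ Real.logb 2 (2 ^ 98 * n * Real.logb 2 (n : ℝ) ^ 12) := redundancy_le_logb hcard
    _ = Real.logb 2 (n : ℝ) + 12 * Real.logb 2 (Real.logb 2 (n : ℝ)) + 98 := by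
        rw [Real.logb_mul (by positivity) (by positivity),
          Real.logb_mul (by positivity) (by positivity), Real.logb_pow, Real.logb_pow,
          Real.logb_self_eq_one one_lt_two]
        push_cast
        ring

end Redundancy

end Recon

theorem theorem6 :
    (∀ n : ℕ, 1 ≤ n → ∀ (s₀ s₁ : ℕ) (g g' : Fin 3 → ℕ), Recon.ValidParams n s₀ s₁ g g' →
      Recon.IsReconstructionCode n 11 (Recon.code11 n s₀ s₁ g g')) ∧
    ∃ K : ℝ, ∀ n : ℕ, 2 ≤ n → ∃ (s₀ s₁ : ℕ) (g g' : Fin 3 → ℕ),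
      Recon.ValidParams n s₀ s₁ g g' ∧ (Recon.code11 n s₀ s₁ g g').Nonempty ∧
      Recon.redundancy n (Recon.code11 n s₀ s₁ g g') ≤
        Real.logb 2 (n : ℝ) + 12 * Real.logb 2 (Real.logb 2 (n : ℝ)) + K :=
  ⟨fun n _ s₀ s₁ g g' _ => Recon.isReconstructionCode_code11 n s₀ s₁ g g',
    98, fun _ hn => Recon.exists_code11_redundancy_le hn⟩
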